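/- **Theorem.** Notation. Let $M_\nu T_t f(x)=e^{2\pi i\nu x}f(x-t)$. A stochastic operator $\mathbf H f=\iint \boldsymbol\eta(t,\nu)\,M_\nu T_t f\,dt\,d\nu$ is given by its stochastic spreading function $\boldsymbol\eta$, a zero-mean generalized random process on $\mathbb R^2$ (a continuous linear map from $C_c^\infty(\mathbb R^2)$ to the square-integrable complex random variables on a probability space). It is WSSUS with scattering function $C$, a locally integrable real function on $\mathbb R^2$, if, in the sense of distributions, $$\mathbb E\{\boldsymbol\eta(t,\nu)\overline{\boldsymbol\eta(t',\nu')}\}=\delta(t-t')\,\delta(\nu-\nu')\,C(t,\nu).$$ If $C$ has compact support, the response to a delta train $u$ is the generalized process $\langle\mathbf H u,\varphi\rangle=\langle\boldsymbol\eta,\ \chi(t,\nu)\,\langle M_\nu T_t u,\varphi\rangle\rangle$, $\varphi\in C_c^\infty(\mathbb R)$ (bilinear pairings), with a cutoff $\chi\in C_c^\infty(\mathbb R^2)$ that equals $1$ near a compact set containing $\operatorname{supp}C$. There is a map $\alpha$ that assigns to every $L\in\mathbb N$ and every $c\in\mathbb C^L$ an array $\alpha=(\alpha_{j,p,p'})$,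 $j\in\{0,\dots,L-1\}^2$, $p,p'\in\{0,\dots,L-1\}$ (so $\alpha$ depends only on $c$), such that the following holds. For every compact set $S\subset\mathbb R^2$, of arbitrary measure $\mu(S)<\infty$, there are a prime $L>\mu(S)$, reals $a,b>0$ with $ab=1/L$, a vector $c\in\mathbb C^L$, and integers $(k_j,n_j)$, $j=(j_1,j_2)\in\{0,\dots,L-1\}^2$, with $k_j\equiv j_1$, $n_j\equiv j_2 \pmod L$, such that the $L^2$ rectangles $[0,a)\times[0,b)+(ak_j,bn_j)$ cover $S$ and such that, for every WSSUS operator $\mathbf H$ whose scattering function $C$ satisfies $\operatorname{supp}C\subseteq S$ and for every cutoff $\chi$ equal to $1$ near $S$, the scattering function is reconstructed from the autocorrelation $R_{\mathbf f}(x,x')=\mathbb E\{\mathbf f(x)\overline{\mathbf f(x')}\}$ of the response $\mathbf f=\mathbf H\,\mathrm{III}_c$ to the $L$-periodic $c$-weighted delta train $\mathrm{III}_c=\sum_{k\in\mathbb Z}c_{k \bmod L}\,\delta_{ak}$, as follows. The distribution $R_{\mathbf f}$ is of the form $R_{\mathbf f}(x,x')=\sum_{d\in\mathbb Z}\Phi_d(x)\,\delta(x-x'-ad)$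 with locally integrable $\Phi_d$. For any such $\Phi_d$, writing $R_{\mathbf f}(x,x-ad)$ for $\Phi_d(x)$, $$C(t,\nu)=b^{-1}\sum_{j}\mathbf 1_{[0,a)\times[0,b)}(t-ak_j,\nu-bn_j)\sum_{p,p'=0}^{L-1}\sum_{m\in\mathbb Z}\alpha_{j,p,p'}\,e^{-2\pi i a[(p-p')(\nu-bn_j)+\nu mL]}\,R_{\mathbf f}\bigl(t-a(k_j-p),\,t-a(k_j+mL-p')\bigr).$$ Here the partial sums over $|m|\le N$ of the right-hand side converge to $C$ as $N\to\infty$ in the sense of distributions on $\mathbb R^2$, and, if $C\in L^2(\mathbb R^2)$, also in $L^2(\mathbb R^2)$. -/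

import Mathlib

open MeasureTheory Set Filter Topology TopologicalSpace
open scoped Distributions ContDiff ComplexConjugate ENNReal

/-- The product `χ g` of a test function `χ` on `ℝ²` with a smooth function `g`, as a test
function. -/
noncomputable def mulSmooth (χ : 𝓓((⊤ : Opens (ℝ × ℝ)), ℂ)) (g : ℝ × ℝ → ℂ) (hg : ContDiff ℝ ∞ g) :
    𝓓((⊤ : Opens (ℝ × ℝ)), ℂ) where
  toFun z := χ z * g z
  contDiff' := χ.contDiff.mul hg
  hasCompactSupport' := χ.hasCompactSupport.mul_right
  tsupport_subset' _ _ := trivial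

/-- A stochastic operator `H f = ∬ η(t,ν) M_ν T_t f dt dν`, given by its stochastic spreading
function `η`: a zero-mean generalized random process on the time-frequency plane, that is, a
continuous linear map from test functions on `ℝ²` to square integrable random variables;
`spreading φ` stands for the random variable `∬ η(t,ν) φ(t,ν) dt dν`. -/
structure StochasticOperator {Ω : Type*} [MeasurableSpace Ω] (P : Measure Ω) where
  spreading : 𝓓((⊤ : Opens (ℝ × ℝ)), ℂ) →L[ℂ] Lp ℂ 2 P
  zero_mean : ∀ φ, ∫ w, spreading φ w ∂P = 0

/-- `H` is a WSSUS operator with scattering function `C`: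
`E[η(t,ν) conj η(t',ν')] = δ(t - t') δ(ν - ν') C(t,ν)` as distributions on `ℝ² × ℝ²`. -/
structure IsWSSUS {Ω : Type*} [MeasurableSpace Ω] {P : Measure Ω} (H : StochasticOperator P)
    (C : ℝ × ℝ → ℝ) : Prop where
  locallyIntegrable : LocallyIntegrable C volume
  autocorrelation_eq : ∀ φ ψ : 𝓓((⊤ : Opens (ℝ × ℝ)), ℂ),
    ∫ w, H.spreading φ w * conj (H.spreading ψ w) ∂P = ∫ z, (C z : ℂ) * (φ z * conj (ψ z))

/-- The weighted delta train `∑_k c_{k mod L} δ_{ak}`, as a functional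
`ψ ↦ ∑_k c_{k mod L} ψ(ak)`. -/
noncomputable def deltaTrain {L : ℕ} (a : ℝ) (c : ZMod L → ℂ) (ψ : ℝ → ℂ) : ℂ :=
  ∑' k : ℤ, c (k : ZMod L) * ψ (a * k)

/-- The function `(t,ν) ↦ ⟨M_ν T_t u, φ⟩` for a functional `u`, with `T_t u(x) = u(x - t)` and
`M_ν u(x) = exp(2πiνx) u(x)`, so that `⟨M_ν T_t u, φ⟩ = ⟨u, y ↦ exp(2πiν(y + t)) φ(y + t)⟩`. -/
noncomputable def timeFrequencyPairing (u : (ℝ → ℂ) → ℂ) (φ : ℝ → ℂ) (z : ℝ × ℝ) : ℂ :=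
  u fun y => Complex.exp (2 * Real.pi * Complex.I * z.2 * (y + z.1)) * φ (y + z.1)

/-- For a delta train the function `(t,ν) ↦ ⟨M_ν T_t u, φ⟩` is smooth. -/
theorem contDiff_timeFrequencyPairing_deltaTrain {L : ℕ} {a : ℝ} (ha : a ≠ 0) (c : ZMod L → ℂ)
    (φ : 𝓓((⊤ : Opens ℝ), ℂ)) : ContDiff ℝ ∞ (timeFrequencyPairing (deltaTrain a c) φ) := by
  obtain ⟨M, hM⟩ := φ.hasCompactSupport.isCompact.isBounded.exists_norm_le
  rw [contDiff_iff_contDiffAt]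
  intro z₀
  set B : ℝ := (M + |z₀.1| + 1) / |a| with hB
  have hapos : 0 < |a| := abs_pos.mpr ha
  set s : Finset ℤ := Finset.Icc (-⌈B⌉) ⌈B⌉ with hs
  have hfin : ∀ᶠ z : ℝ × ℝ in 𝓝 z₀, timeFrequencyPairing (deltaTrain a c) φ z
      = ∑ k ∈ s, c (k : ZMod L) * (Complex.exp (2 * Real.pi * Complex.I * z.2 *
          ((a * k : ℝ) + z.1)) * φ (a * k + z.1)) := by
    have h1 : ∀ᶠ z : ℝ × ℝ in 𝓝 z₀, |z.1 - z₀.1| < 1 := by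
      have : Continuous fun z : ℝ × ℝ => |z.1 - z₀.1| := by fun_prop
      refine this.continuousAt.eventually_lt continuousAt_const ?_
      simp
    filter_upwards [h1] with z hz
    unfold timeFrequencyPairing deltaTrain
    refine tsum_eq_sum fun k hk => ?_
    have h0 : φ (a * k + z.1) = 0 := by
      by_contra hne
      apply hk
      have h2 := hM _ (subset_tsupport _ (Function.mem_support.mpr hne))
      rw [Real.norm_eq_abs] at h2
      have h3 : |a * k| ≤ M + |z₀.1| + 1 := by
        have e : a * k = (a * k + z.1) - (z.1 - z₀.1) - z₀.1 := by ring
        rw [e]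
        have i1 := abs_sub ((a * k + z.1) - (z.1 - z₀.1)) z₀.1
        have i2 := abs_sub (a * k + z.1) (z.1 - z₀.1)
        linarith
      have h4 : |(k : ℝ)| ≤ B := by
        rw [hB, le_div_iff₀ hapos, mul_comm, ← abs_mul]
        exact h3
      have h5 := abs_le.mp (h4.trans (Int.le_ceil B))
      rw [hs, Finset.mem_Icc]
      constructor
      · exact_mod_cast h5.1
      · exact_mod_cast h5.2
    simp only [h0, mul_zero]
  refine ContDiffAt.congr_of_eventuallyEq ?_ hfin
  refine ContDiff.contDiffAt ?_
  refine ContDiff.sum fun k _ => ?_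
  have hφ : ContDiff ℝ ∞ fun z : ℝ × ℝ => φ (a * k + z.1) :=
    φ.contDiff.comp (contDiff_const.add contDiff_fst)
  have h1 : ContDiff ℝ ∞ fun z : ℝ × ℝ => ((z.1 : ℝ) : ℂ) :=
    Complex.ofRealCLM.contDiff.comp contDiff_fst
  have h2 : ContDiff ℝ ∞ fun z : ℝ × ℝ => ((z.2 : ℝ) : ℂ) :=
    Complex.ofRealCLM.contDiff.comp contDiff_snd
  exact contDiff_const.mul
    (((contDiff_const.mul h2).mul (contDiff_const.add h1)).cexp.mul hφ)

open Classical in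
/-- The response `H u` to an input functional `u`, as a generalized random process on `ℝ`:
`⟨H u, φ⟩ = ∬ η(t,ν) ⟨M_ν T_t u, φ⟩ dt dν`. The function `(t,ν) ↦ ⟨M_ν T_t u, φ⟩` is smooth, but
its support need not be compact, so the compactly supported `η` is paired with its product with a
cutoff function `χ` that equals one near the support of `η`.
(The value `0` is used if this function is not smooth; this does not occur for delta trains.) -/
noncomputable def StochasticOperator.response {Ω : Type*} [MeasurableSpace Ω] {P : Measure Ω}
    (H : StochasticOperator P) (χ : 𝓓((⊤ : Opens (ℝ × ℝ)), ℂ)) (u : (ℝ → ℂ) → ℂ)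
    (φ : 𝓓((⊤ : Opens ℝ), ℂ)) : Lp ℂ 2 P :=
  if h : ContDiff ℝ ∞ (timeFrequencyPairing u φ) then
    H.spreading (mulSmooth χ (timeFrequencyPairing u φ) h)
  else 0

theorem StochasticOperator.response_deltaTrain {Ω : Type*} [MeasurableSpace Ω] {P : Measure Ω}
    (H : StochasticOperator P) (χ : 𝓓((⊤ : Opens (ℝ × ℝ)), ℂ)) {L : ℕ} {a : ℝ} (ha : a ≠ 0)
    (c : ZMod L → ℂ) (φ : 𝓓((⊤ : Opens ℝ), ℂ)) :
    H.response χ (deltaTrain a c) φ =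
      H.spreading (mulSmooth χ (timeFrequencyPairing (deltaTrain a c) φ)
        (contDiff_timeFrequencyPairing_deltaTrain ha c φ)) :=
  dif_pos _

/-- The autocorrelation `R_f(x,x') = E[f(x) conj f(x')]` of a generalized random process `f` on
`ℝ`, as the sesquilinear form `(φ,ψ) ↦ E[f(φ) conj f(ψ)]`, which stands for
`∬ R_f(x,x') φ(x) conj ψ(x') dx dx'`. -/
noncomputable def autocorrelation {Ω : Type*} [MeasurableSpace Ω] {P : Measure Ω}
    (f : 𝓓((⊤ : Opens ℝ), ℂ) → Lp ℂ 2 P) (φ ψ : 𝓓((⊤ : Opens ℝ), ℂ)) : ℂ :=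
  ∫ w, f φ w * conj (f ψ w) ∂P

/-- The distribution `R` on `ℝ²` is carried by the lines `x - x' ∈ aℤ`, with density `Φ d` on the
line `x - x' = ad`: `R(x,x') = ∑_d Φ_d(x) δ(x - x' - ad)`.
Thus `Φ d x` is what is meant by the value of `R` at the point `(x, x - ad)`. -/
structure IsLineDensity (a : ℝ) (R : 𝓓((⊤ : Opens ℝ), ℂ) → 𝓓((⊤ : Opens ℝ), ℂ) → ℂ)
    (Φ : ℤ → ℝ → ℂ) : Prop where
  locallyIntegrable : ∀ d, LocallyIntegrable (Φ d) volume
  hasSum : ∀ φ ψ : 𝓓((⊤ : Opens ℝ), ℂ),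
    HasSum (fun d : ℤ => ∫ x, Φ d x * (φ x * conj (ψ (x - a * d)))) (R φ ψ)

/-- The rectangle `[0,a) × [0,b)`. -/
def prototypeBox (a b : ℝ) : Set (ℝ × ℝ) := Ico 0 a ×ˢ Ico 0 b

/-- The translations `[0,a) × [0,b) + (a k_j, b n_j)` cover `S`, and the indices `(k_j, n_j)` run
through all `L²` residue classes modulo `L` (so they are distinct modulo `L`). -/
structure IsRectification (a b : ℝ) {L : ℕ} (k n : Fin L × Fin L → ℤ) (S : Set (ℝ × ℝ)) :
    Prop where
  k_modEq : ∀ j, k j ≡ (j.1 : ℕ) [ZMOD L]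
  n_modEq : ∀ j, n j ≡ (j.2 : ℕ) [ZMOD L]
  subset : S ⊆ ⋃ j, {z | (z.1 - a * k j, z.2 - b * n j) ∈ prototypeBox a b}

/-- The right-hand side of the reconstruction formula, with the series over `m ∈ ℤ` truncated to
`|m| ≤ N`:
`b⁻¹ ∑_j 1_{[0,a)×[0,b)}(t - a k_j, ν - b n_j) ∑_{p,p'} ∑_{|m| ≤ N} α_{j,p,p'}`
`  exp(-2πia[(p - p')(ν - b n_j) + νmL]) R(t - a(k_j - p), t - a(k_j + mL - p'))`,
the last factor being `Φ_{p - p' + mL}(t - a(k_j - p))`. -/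
noncomputable def reconstruction (a b : ℝ) {L : ℕ} (α : Fin L × Fin L → Fin L → Fin L → ℂ)
    (k n : Fin L × Fin L → ℤ) (Φ : ℤ → ℝ → ℂ) (N : ℕ) (z : ℝ × ℝ) : ℂ :=
  (b : ℂ)⁻¹ * ∑ j : Fin L × Fin L,
    (prototypeBox a b).indicator (fun _ => (1 : ℂ)) (z.1 - a * k j, z.2 - b * n j) *
      ∑ p : Fin L, ∑ p' : Fin L, ∑ m ∈ Finset.Icc (-(N : ℤ)) N,
        α j p p' *
          Complex.exp (-(2 * Real.pi * Complex.I * a *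
            (((p : ℕ) - (p' : ℕ) : ℂ) * (z.2 - b * n j) + z.2 * m * L))) *
          Φ ((p : ℕ) - (p' : ℕ) + m * L) (z.1 - a * (k j - (p : ℕ)))

/-! Formally, the response at `x` is the superposition over `k` of `c_k ∫ η(x - ak, ν) exp(2πiνx)
dν`. The WSSUS relation leaves only the lines `x - x' = ad` in its autocorrelation, with density
`Φ_d(x) = ∑_k c_k conj(c_{k-d}) Ĉ(x - ak, ad)`, where `Ĉ(t, y) = ∫ C(t,ν) exp(2πiνy) dν`
(`isLineDensity_responseDensity`). Bump functions narrower than the line spacing show that such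
densities are unique almost everywhere (`IsLineDensity.ae_eq`), so every admissible `Φ` is this one.

Let `C` live on tiles with corners `(aκ_i, bκ_l)`, `κ_i ≡ i` mod `L`. At `x = s + ap` with `s ∈
[0,a)`, each column `i` contributes one `k`, namely `p - κ_i`. Since `abL = 1`, the frequency `a(p -
p' + mL)` equals `a(p - p') + m/b`: for fixed `p, p'`, the values over `m` are the Fourier
coefficients on `[0,b)` of a combination of all tile pieces, each modulated by `exp(2πia(p - p')v)`,
with coefficients the entries of `π(j)c ⊗ conj(π(j)c)` (`exp_mul_responseDensity_eq`). Summing over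
`m` inverts the Fourier series, and an array biorthogonal to these rank one matrices isolates a
single tile (`reconstruction_sub_eq_tileError`).

The biorthogonal array exists because the `L²` matrices are linearly independent, which follows once
the discrete ambiguity function of `c` has no zero. The window `(1, 2, 4, …)` with `L` odd has this
property by summing geometric series (`ambiguity_geometricWindow_ne_zero`, `exists_isDualArray`).

What remains is convergence of symmetric Fourier partial sums in `ν`. In `L²` it is Parseval on
almost every slice plus dominated convergence. For merely integrable `C` the partial sums need not
converge in `L¹`; the symmetry of the Dirichlet kernel moves them onto the test function. Cut to
`[0,b)`, that function is not periodic, so uniform convergence fails, but its partial sums are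
uniformly bounded (`norm_fourierPartialSum_le`, resting on the bounded sawtooth sums) and converge
in `L²`, which suffices by dominated convergence along subsequences.

For the geometry, take `a = b = 1/√L` with `L` a large prime: the tiles with indices centred at zero
form a square of side `√L`, which swallows any bounded set. -/

/-! ### Bounded partial sums of the sawtooth series -/

theorem abs_sin_nat_mul_le (n : ℕ) (x : ℝ) : |Real.sin (n * x)| ≤ n * |Real.sin x| := by
  induction n with
  | zero => simp
  | succ n ih =>
    push_cast
    rw [add_mul, one_mul, Real.sin_add, add_mul, one_mul]
    refine (abs_add_le _ _).trans ?_
    rw [abs_mul, abs_mul]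
    have h1 := Real.abs_cos_le_one x
    have h2 := Real.abs_cos_le_one (n * x)
    have := mul_le_of_le_one_right (abs_nonneg (Real.sin (n * x))) h1
    have := mul_le_of_le_one_left (abs_nonneg (Real.sin x)) h2
    linarith

/-- Summation by parts: `2 sin(x/2) sin((m+1)x)` telescopes as a difference of cosines at
half-integers, and the weights `1/m` decrease. -/
theorem abs_sum_sin_div_tail_le (x : ℝ) (n k : ℕ) :
    |Real.sin (x / 2)| * |∑ i ∈ Finset.range k, Real.sin ((n + i + 1 : ℕ) * x) / (n + i + 1 : ℕ)|
      ≤ 1 / (n + 1) := by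
  set C : ℕ → ℝ := fun m => Real.cos ((m + 1 / 2) * x) with hC
  have hC1 : ∀ m, |C m| ≤ 1 := fun m => Real.abs_cos_le_one _
  have hsin : ∀ m : ℕ, Real.sin (x / 2) * Real.sin ((m + 1 : ℕ) * x) = (C m - C (m + 1)) / 2 := by
    intro m
    have e1 : ((m : ℝ) + 1 / 2) * x = (m + 1 : ℕ) * x - x / 2 := by push_cast; ring
    have e2 : (((m + 1 : ℕ) : ℝ) + 1 / 2) * x = (m + 1 : ℕ) * x + x / 2 := by push_cast; ring
    simp only [hC]
    rw [e1, e2, Real.cos_sub, Real.cos_add]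
    ring
  -- Keeping the boundary term `C (n + k) / (n + k + 1)` on the left makes the induction close: each
  -- step adds only `C (n + k + 1)` times a difference of consecutive weights, and these differences
  -- telescope.
  have key : ∀ k : ℕ, |2 * (Real.sin (x / 2) *
      ∑ i ∈ Finset.range k, Real.sin ((n + i + 1 : ℕ) * x) / (n + i + 1 : ℕ))
        + C (n + k) / (n + k + 1)| ≤ 2 / (n + 1) - 1 / (n + k + 1) := by
    intro k
    induction k with
    | zero =>
      have hn : (0 : ℝ) < n + 1 := by positivity
      have : (2 : ℝ) / (n + 1) - 1 / (n + 1) = 1 / (n + 1) := by ring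
      simp only [Finset.range_zero, Finset.sum_empty, mul_zero, zero_add, add_zero, Nat.cast_zero,
        this, abs_div, abs_of_pos hn]
      gcongr
      exact hC1 n
    | succ k ih =>
      have hp : (0 : ℝ) < n + k + 1 := by positivity
      have hq : (0 : ℝ) < n + k + 2 := by positivity
      have e : 2 * (Real.sin (x / 2) *
          ∑ i ∈ Finset.range (k + 1), Real.sin ((n + i + 1 : ℕ) * x) / (n + i + 1 : ℕ))
            + C (n + (k + 1)) / (n + (k + 1 : ℕ) + 1)
          = (2 * (Real.sin (x / 2) *
              ∑ i ∈ Finset.range k, Real.sin ((n + i + 1 : ℕ) * x) / (n + i + 1 : ℕ))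
            + C (n + k) / (n + k + 1))
            + C (n + k + 1) * (1 / (n + k + 2) - 1 / (n + k + 1)) := by
        rw [Finset.sum_range_succ, mul_add, ← mul_div_assoc, hsin]
        push_cast
        rw [← add_assoc n k 1]
        field_simp
        ring
      rw [e]
      refine (abs_add_le _ _).trans ?_
      rw [abs_mul]
      have h3 : |(1 : ℝ) / (n + k + 2) - 1 / (n + k + 1)| = 1 / (n + k + 1) - 1 / (n + k + 2) := by
        rw [abs_sub_comm, abs_of_nonneg]
        rw [sub_nonneg]
        gcongr
        norm_num
      have h4 := mul_le_of_le_one_left (abs_nonneg ((1 : ℝ) / (n + k + 2) - 1 / (n + k + 1)))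
        (hC1 (n + k + 1))
      have e5 : (n : ℝ) + ((k + 1 : ℕ) : ℝ) + 1 = n + k + 2 := by push_cast; ring
      rw [e5]
      linarith
  have h := key k
  have h2 : |C (n + k) / (n + k + 1)| ≤ 1 / (n + k + 1) := by
    have hp : (0 : ℝ) < n + k + 1 := by positivity
    rw [abs_div, abs_of_pos hp]
    gcongr
    exact hC1 _
  have h3 := abs_sub_abs_le_abs_add (2 * (Real.sin (x / 2) *
      ∑ i ∈ Finset.range k, Real.sin ((n + i + 1 : ℕ) * x) / (n + i + 1 : ℕ)))
      (C (n + k) / (n + k + 1))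
  rw [abs_mul, abs_mul, abs_two] at h3
  have : (2 : ℝ) / (n + 1) = 2 * (1 / (n + 1)) := by ring
  linarith

/-- The partial sums of `∑ sin (m x) / m` are uniformly bounded. -/
theorem abs_sum_sin_div_le (x : ℝ) (N : ℕ) :
    |∑ i ∈ Finset.range N, Real.sin ((i + 1 : ℕ) * x) / (i + 1 : ℕ)| ≤ 3 := by
  set δ := |Real.sin (x / 2)| with hδ
  have hsin : |Real.sin x| ≤ 2 * δ := by
    have : Real.sin x = 2 * Real.sin (x / 2) * Real.cos (x / 2) := by
      rw [← Real.sin_two_mul]; ring_nf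
    rw [this, abs_mul, abs_mul, abs_two]
    exact mul_le_of_le_one_right (by positivity) (Real.abs_cos_le_one _)
  have hhead : ∀ n : ℕ, |∑ i ∈ Finset.range n, Real.sin ((i + 1 : ℕ) * x) / (i + 1 : ℕ)|
      ≤ n * (2 * δ) := by
    intro n
    refine (Finset.abs_sum_le_sum_abs _ _).trans ?_
    rw [← nsmul_eq_mul]
    conv_rhs => rw [← Finset.card_range n]
    refine Finset.sum_le_card_nsmul _ _ _ fun i _ => ?_
    have hp : (0 : ℝ) < (i + 1 : ℕ) := by positivity
    rw [abs_div, abs_of_pos hp, div_le_iff₀' hp]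
    exact (abs_sin_nat_mul_le _ _).trans (mul_le_mul_of_nonneg_left hsin hp.le)
  rcases eq_or_lt_of_le (abs_nonneg (Real.sin (x / 2))) with h0 | h0
  · have := hhead N
    rw [hδ, ← h0] at this
    linarith
  rw [← hδ] at h0
  -- Cut where `nδ` is about `1`: each of the first `n` terms is at most `2δ`, so the head is at
  -- most `2`; the tail is at most `1 / ((n + 1)δ) ≤ 1`.
  set n := ⌊1 / δ⌋₊ with hn
  have hn1 : (n : ℝ) * δ ≤ 1 := by
    rw [← le_div_iff₀ h0]; exact Nat.floor_le (by positivity)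
  have hn2 : 1 ≤ (n + 1) * δ := by
    rw [← div_le_iff₀ h0]; exact (Nat.lt_floor_add_one _).le
  rcases le_total N n with hN | hN
  · have h1 := hhead N
    have : (N : ℝ) * δ ≤ n * δ := by gcongr
    linarith
  · obtain ⟨k, rfl⟩ := Nat.exists_eq_add_of_le hN
    rw [Finset.sum_range_add]
    refine (abs_add_le _ _).trans ?_
    have h1 := hhead n
    have h2 := abs_sum_sin_div_tail_le x n k
    rw [← hδ] at h2
    have h3 : |∑ i ∈ Finset.range k, Real.sin ((n + i + 1 : ℕ) * x) / (n + i + 1 : ℕ)| ≤ 1 := by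
      by_contra! hc
      have : (n + 1) * (δ * |∑ i ∈ Finset.range k,
          Real.sin ((n + i + 1 : ℕ) * x) / (n + i + 1 : ℕ)|) ≤ 1 := by
        rw [le_div_iff₀ (by positivity)] at h2
        linarith
      nlinarith
    linarith

/-! ### Fourier partial sums on an interval -/

/-- The character `w ↦ exp (2πi m w / b)`. -/
noncomputable def wave (b : ℝ) (m : ℤ) (w : ℝ) : ℂ :=
  Complex.exp (2 * Real.pi * Complex.I * m * w / b)

theorem wave_neg (b : ℝ) (m : ℤ) (w : ℝ) : wave b (-m) w = conj (wave b m w) := by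
  unfold wave
  rw [← Complex.exp_conj]
  congr 1
  simp [Complex.conj_ofNat, neg_div]

theorem norm_wave (b : ℝ) (m : ℤ) (w : ℝ) : ‖wave b m w‖ = 1 := by
  unfold wave
  rw [show (2 * Real.pi * Complex.I * m * w / b : ℂ) = ((2 * Real.pi * m * w / b : ℝ) : ℂ)
    * Complex.I by push_cast; ring]
  exact Complex.norm_exp_ofReal_mul_I _

theorem continuous_wave (b : ℝ) (m : ℤ) : Continuous (wave b m) := by
  unfold wave; fun_prop

theorem wave_sub (b : ℝ) (m : ℤ) (v w : ℝ) : wave b m (v - w) = wave b m v * wave b (-m) w := by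
  unfold wave
  rw [← Complex.exp_add]
  congr 1
  push_cast; ring

/-- The symmetric partial sum of order `N` of the Fourier series of `f` on `[0, b)`. -/
noncomputable def fourierPartialSum (b : ℝ) (N : ℕ) (f : ℝ → ℂ) (w : ℝ) : ℂ :=
  (b : ℂ)⁻¹ * ∑ m ∈ Finset.Icc (-(N : ℤ)) N, wave b (-m) w * ∫ v in Ico 0 b, f v * wave b m v

theorem sum_Icc_neg_succ {M : Type*} [AddCommMonoid M] (g : ℤ → M) (N : ℕ) :
    ∑ m ∈ Finset.Icc (-((N + 1 : ℕ) : ℤ)) (N + 1 : ℕ), g m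
      = (∑ m ∈ Finset.Icc (-(N : ℤ)) N, g m) + (g (N + 1) + g (-(N + 1))) := by
  have : Finset.Icc (-((N + 1 : ℕ) : ℤ)) (N + 1 : ℕ)
      = insert ((N : ℤ) + 1) (insert (-((N : ℤ) + 1)) (Finset.Icc (-(N : ℤ)) N)) := by
    ext m
    simp only [Finset.mem_Icc, Finset.mem_insert]
    push_cast
    omega
  rw [this, Finset.sum_insert, Finset.sum_insert, ← add_assoc, add_comm]
  · simp only [Finset.mem_Icc]; omega
  · simp only [Finset.mem_Icc, Finset.mem_insert]; omega

theorem sum_Icc_neg_comp_neg {M : Type*} [AddCommMonoid M] (g : ℤ → M) (N : ℕ) :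
    ∑ m ∈ Finset.Icc (-(N : ℤ)) N, g (-m) = ∑ m ∈ Finset.Icc (-(N : ℤ)) N, g m := by
  refine Finset.sum_nbij' (fun m => -m) (fun m => -m) ?_ ?_ ?_ ?_ ?_ <;>
    simp only [Finset.mem_Icc, neg_neg, implies_true] <;> intros <;> omega

/-- The antiderivative of the Dirichlet kernel. -/
noncomputable def dirichletIntegral (b : ℝ) (N : ℕ) (x : ℝ) : ℝ :=
  x / b + Real.pi⁻¹ * ∑ i ∈ Finset.range N,
    Real.sin ((i + 1 : ℕ) * (2 * Real.pi * x / b)) / (i + 1 : ℕ)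

theorem abs_dirichletIntegral_le {b : ℝ} (hb : 0 < b) (N : ℕ) {x : ℝ} (hx : |x| ≤ b) :
    |dirichletIntegral b N x| ≤ 4 := by
  unfold dirichletIntegral
  refine (abs_add_le _ _).trans ?_
  have h1 : |x / b| ≤ 1 := by
    rw [abs_div, abs_of_pos hb]; exact div_le_one_of_le₀ hx hb.le
  have h2 := abs_sum_sin_div_le (2 * Real.pi * x / b) N
  have h3 : |Real.pi⁻¹| ≤ 1 := by
    rw [abs_of_pos (by positivity)]
    exact inv_le_one_of_one_le₀ (by linarith [Real.pi_gt_three])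
  rw [abs_mul]
  have := mul_le_of_le_one_left (abs_nonneg (∑ i ∈ Finset.range N,
    Real.sin ((i + 1 : ℕ) * (2 * Real.pi * x / b)) / (i + 1 : ℕ))) h3
  linarith

theorem hasDerivAt_dirichletIntegral {b : ℝ} (hb : 0 < b) (N : ℕ) (x : ℝ) :
    HasDerivAt (fun x => (dirichletIntegral b N x : ℂ))
      ((b : ℂ)⁻¹ * ∑ m ∈ Finset.Icc (-(N : ℤ)) N, wave b m x) x := by
  have key : HasDerivAt (dirichletIntegral b N)
      (1 / b + Real.pi⁻¹ * ∑ i ∈ Finset.range N,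
        (Real.cos ((i + 1 : ℕ) * (2 * Real.pi * x / b)) *
          ((i + 1 : ℕ) * (2 * Real.pi * 1 / b))) / (i + 1 : ℕ)) x := by
    unfold dirichletIntegral
    refine ((hasDerivAt_id x).div_const b).add (HasDerivAt.const_mul _ ?_)
    refine HasDerivAt.fun_sum fun i _ => ?_
    refine HasDerivAt.div_const ?_ _
    refine HasDerivAt.sin ?_
    exact (((hasDerivAt_id x).const_mul _).div_const b).const_mul _
  convert key.ofReal_comp using 1
  have hb' : (b : ℂ) ≠ 0 := by exact_mod_cast hb.ne'
  have hpi : (Real.pi : ℂ) ≠ 0 := by exact_mod_cast Real.pi_ne_zero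
  clear key
  -- The modes `m` and `-m` pair up into twice a cosine, the derivative of one sine term.
  induction N with
  | zero => simp [wave]
  | succ N ih =>
    rw [sum_Icc_neg_succ, mul_add, ih, Finset.sum_range_succ]
    push_cast
    have hN : ((N : ℂ) + 1) ≠ 0 := by exact_mod_cast Nat.succ_ne_zero N
    have hw : wave b (N + 1) x + wave b (-(N + 1)) x
        = 2 * Complex.cos ((N + 1) * (2 * Real.pi * x / b)) := by
      rw [Complex.two_cos]
      unfold wave
      congr 2 <;> push_cast <;> ring
    rw [hw, mul_add (Real.pi : ℂ)⁻¹, ← add_assoc]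
    congr 1
    field_simp

theorem fourierPartialSum_eq_integral {b : ℝ} (N : ℕ) {f : ℝ → ℂ}
    (hf : IntegrableOn f (Ico 0 b)) (w : ℝ) :
    fourierPartialSum b N f w = ∫ v in Ico 0 b,
      f v * ((b : ℂ)⁻¹ * ∑ m ∈ Finset.Icc (-(N : ℤ)) N, wave b m (v - w)) := by
  have hi : ∀ m, IntegrableOn (fun v => f v * wave b m v) (Ico 0 b) := fun m =>
    hf.mul_bdd (c := 1) (continuous_wave b m).aestronglyMeasurable
      (ae_of_all _ fun v => (norm_wave b m v).le)
  unfold fourierPartialSum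
  simp_rw [← integral_const_mul]
  rw [← integral_finsetSum _ fun m _ => (hi m).const_mul _, ← integral_const_mul]
  congr 1
  ext v
  simp_rw [Finset.mul_sum, wave_sub]
  exact Finset.sum_congr rfl fun m _ => by ring

/-- Partial sums of the Fourier series of a `C¹` function on an interval are uniformly bounded. -/
theorem norm_fourierPartialSum_le {b : ℝ} (hb : 0 < b) (N : ℕ) {f f' : ℝ → ℂ} {M : ℝ}
    (hf : ∀ x, HasDerivAt f (f' x) x) (hf' : Continuous f') (h0 : ∀ x ∈ Icc 0 b, ‖f x‖ ≤ M)
    (h1 : ∀ x ∈ Icc 0 b, ‖f' x‖ ≤ M) {w : ℝ} (hw : w ∈ Icc 0 b) :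
    ‖fourierPartialSum b N f w‖ ≤ 4 * M * (2 + b) := by
  have hfc : Continuous f := continuous_iff_continuousAt.mpr fun x => (hf x).continuousAt
  have hfi : IntegrableOn f (Ico 0 b) :=
    (hfc.continuousOn.integrableOn_compact isCompact_Icc).mono_set Ico_subset_Icc_self
  have hV : ∀ v, HasDerivAt (fun v => (dirichletIntegral b N (v - w) : ℂ))
      ((b : ℂ)⁻¹ * ∑ m ∈ Finset.Icc (-(N : ℤ)) N, wave b m (v - w)) v := by
    intro v
    exact (hasDerivAt_dirichletIntegral hb N (v - w)).comp_sub_const v w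
  have hVc : Continuous fun v => (dirichletIntegral b N (v - w) : ℂ) :=
    continuous_iff_continuousAt.mpr fun x => (hV x).continuousAt
  have hDc : Continuous fun v : ℝ =>
      (b : ℂ)⁻¹ * ∑ m ∈ Finset.Icc (-(N : ℤ)) N, wave b m (v - w) := by
    refine continuous_const.mul (continuous_finsetSum _ fun m _ => ?_)
    exact (continuous_wave b m).comp (continuous_id.sub continuous_const)
  -- Integration by parts replaces the Dirichlet kernel, unbounded in `L¹` as `N` grows, by its
  -- antiderivative, bounded by `4`. Since `f` is not periodic both endpoint terms survive; they
  -- give the `2` in `2 + b`.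
  rw [fourierPartialSum_eq_integral N hfi, integral_Ico_eq_integral_Ioc,
    ← intervalIntegral.integral_of_le hb.le,
    intervalIntegral.integral_mul_deriv_eq_deriv_mul (fun x _ => hf x) (fun x _ => hV x)
      (hf'.intervalIntegrable _ _) (hDc.intervalIntegrable _ _)]
  have hVb : ∀ v ∈ Icc 0 b, ‖(dirichletIntegral b N (v - w) : ℂ)‖ ≤ 4 := by
    intro v hv
    rw [Complex.norm_real]
    refine abs_dirichletIntegral_le hb N (abs_le.mpr ⟨?_, ?_⟩) <;> linarith [hv.1, hv.2, hw.1, hw.2]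
  have hl : (0 : ℝ) ∈ Icc 0 b := ⟨le_rfl, hb.le⟩
  have hr : b ∈ Icc 0 b := ⟨hb.le, le_rfl⟩
  have hM : 0 ≤ M := (norm_nonneg _).trans (h0 0 hl)
  have hI : ‖∫ v in (0 : ℝ)..b, f' v * (dirichletIntegral b N (v - w) : ℂ)‖ ≤ M * 4 * |b - 0| := by
    refine intervalIntegral.norm_integral_le_of_norm_le_const fun v hv => ?_
    rw [uIoc_of_le hb.le] at hv
    rw [norm_mul]
    exact mul_le_mul (h1 v ⟨hv.1.le, hv.2⟩) (hVb v ⟨hv.1.le, hv.2⟩) (norm_nonneg _) hM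
  have hB : ∀ v ∈ Icc 0 b, ‖f v * (dirichletIntegral b N (v - w) : ℂ)‖ ≤ M * 4 := fun v hv => by
    rw [norm_mul]
    exact mul_le_mul (h0 v hv) (hVb v hv) (norm_nonneg _) hM
  rw [sub_zero, abs_of_pos hb] at hI
  refine (norm_sub_le _ _).trans ?_
  have := norm_sub_le (f b * (dirichletIntegral b N (b - w) : ℂ))
    (f 0 * (dirichletIntegral b N (0 - w) : ℂ))
  have := hB b hr
  have := hB 0 hl
  linarith

/-! ### Orthogonality of the characters and `L²` convergence on an interval. -/

theorem wave_add (b : ℝ) (m n : ℤ) (w : ℝ) : wave b (m + n) w = wave b m w * wave b n w := by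
  unfold wave
  rw [← Complex.exp_add]
  congr 1
  push_cast; ring

theorem integral_wave {b : ℝ} (hb : 0 < b) (m : ℤ) :
    ∫ v in Ico 0 b, wave b m v = if m = 0 then (b : ℂ) else 0 := by
  rw [integral_Ico_eq_integral_Ioc, ← intervalIntegral.integral_of_le hb.le]
  have hb' : (b : ℂ) ≠ 0 := by exact_mod_cast hb.ne'
  split_ifs with h
  · simp [h, wave]
  · have hc : (2 * Real.pi * Complex.I * m / b : ℂ) ≠ 0 := by
      have : (m : ℂ) ≠ 0 := by exact_mod_cast h
      have := Complex.two_pi_I_ne_zero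
      positivity
    have e : ∀ v : ℝ, wave b m v = Complex.exp ((2 * Real.pi * Complex.I * m / b) * v) := by
      intro v; unfold wave; congr 1; ring
    simp_rw [e]
    rw [integral_exp_mul_complex hc]
    have : (2 * Real.pi * Complex.I * m / b : ℂ) * b = m * (2 * Real.pi * Complex.I) := by
      field_simp
    rw [this, Complex.exp_int_mul_two_pi_mul_I]
    simp

theorem integrable_mul_wave {b : ℝ} {f : ℝ → ℂ} (hf : IntegrableOn f (Ico 0 b)) (m : ℤ) :
    IntegrableOn (fun v => f v * wave b m v) (Ico 0 b) :=
  hf.mul_bdd (c := 1) (continuous_wave b m).aestronglyMeasurable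
    (ae_of_all _ fun v => (norm_wave b m v).le)

/-- The Fourier coefficient `b⁻¹ ∫ f(v) exp (2πi m v / b) dv`. -/
noncomputable def waveCoeff (b : ℝ) (f : ℝ → ℂ) (m : ℤ) : ℂ :=
  (b : ℂ)⁻¹ * ∫ v in Ico 0 b, f v * wave b m v

theorem fourierPartialSum_eq (b : ℝ) (N : ℕ) (f : ℝ → ℂ) (w : ℝ) :
    fourierPartialSum b N f w
      = ∑ m ∈ Finset.Icc (-(N : ℤ)) N, waveCoeff b f m * wave b (-m) w := by
  unfold fourierPartialSum waveCoeff
  rw [Finset.mul_sum]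
  exact Finset.sum_congr rfl fun m _ => by ring

theorem continuous_fourierPartialSum (b : ℝ) (N : ℕ) (f : ℝ → ℂ) :
    Continuous (fourierPartialSum b N f) := by
  unfold fourierPartialSum
  exact continuous_const.mul (continuous_finsetSum _ fun m _ =>
    (continuous_wave b _).mul continuous_const)

theorem integral_mul_conj_fourierPartialSum {b : ℝ} (hb : 0 < b) (N : ℕ) (f : ℝ → ℂ) {g : ℝ → ℂ}
    (hg : IntegrableOn g (Ico 0 b)) :
    ∫ v in Ico 0 b, g v * conj (fourierPartialSum b N f v)
      = b * ∑ m ∈ Finset.Icc (-(N : ℤ)) N, waveCoeff b g m * conj (waveCoeff b f m) := by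
  have hb' : (b : ℂ) ≠ 0 := by exact_mod_cast hb.ne'
  have e : ∀ v, g v * conj (fourierPartialSum b N f v)
      = ∑ m ∈ Finset.Icc (-(N : ℤ)) N, conj (waveCoeff b f m) * (g v * wave b m v) := by
    intro v
    rw [fourierPartialSum_eq, map_sum, Finset.mul_sum]
    refine Finset.sum_congr rfl fun m _ => ?_
    rw [map_mul, wave_neg, Complex.conj_conj]
    ring
  simp_rw [e]
  rw [integral_finsetSum _ fun m _ => (integrable_mul_wave hg m).const_mul _, Finset.mul_sum]
  refine Finset.sum_congr rfl fun m _ => ?_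
  rw [integral_const_mul]
  unfold waveCoeff
  field_simp

theorem waveCoeff_fourierPartialSum {b : ℝ} (hb : 0 < b) (N : ℕ) (f : ℝ → ℂ) {m : ℤ}
    (hm : m ∈ Finset.Icc (-(N : ℤ)) N) :
    waveCoeff b (fourierPartialSum b N f) m = waveCoeff b f m := by
  have hb' : (b : ℂ) ≠ 0 := by exact_mod_cast hb.ne'
  have e : ∀ v, fourierPartialSum b N f v * wave b m v
      = ∑ n ∈ Finset.Icc (-(N : ℤ)) N, waveCoeff b f n * wave b (-n + m) v := by
    intro v
    rw [fourierPartialSum_eq, Finset.sum_mul]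
    exact Finset.sum_congr rfl fun n _ => by rw [wave_add]; ring
  conv_lhs => unfold waveCoeff
  simp_rw [e]
  have hi : ∀ n, IntegrableOn (fun v => wave b n v) (Ico 0 b) := fun n =>
    ((continuous_wave b n).continuousOn.integrableOn_compact isCompact_Icc).mono_set
      Ico_subset_Icc_self
  rw [integral_finsetSum _ fun n _ => (hi _).const_mul _]
  simp_rw [integral_const_mul, integral_wave hb]
  rw [Finset.sum_eq_single m]
  · simp; field_simp
  · intro n _ hn
    rw [if_neg (by omega), mul_zero]
  · exact fun h => absurd hm h

/-- Pythagoras: the partial sum `S` is an orthogonal projection of `f`, so `⟨f, S⟩ = ⟨S, S⟩`, both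
equal to `b` times the sum of squared coefficients. -/
theorem integral_norm_sub_fourierPartialSum_sq {b : ℝ} (hb : 0 < b) (N : ℕ) {f : ℝ → ℂ}
    (hf : MemLp f 2 (volume.restrict (Ico 0 b))) :
    ∫ v in Ico 0 b, ‖fourierPartialSum b N f v - f v‖ ^ 2
      = (∫ v in Ico 0 b, ‖f v‖ ^ 2) - b * ∑ m ∈ Finset.Icc (-(N : ℤ)) N, ‖waveCoeff b f m‖ ^ 2 := by
  set S := fourierPartialSum b N f with hS
  have hSm : MemLp S 2 (volume.restrict (Ico 0 b)) := by
    have hc := continuous_fourierPartialSum b N f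
    obtain ⟨K, hK⟩ := isCompact_Icc.exists_bound_of_continuousOn (s := Icc 0 b) hc.continuousOn
    refine MemLp.of_bound hc.aestronglyMeasurable K ?_
    filter_upwards [ae_restrict_mem measurableSet_Ico] with v hv
    exact hK v (Ico_subset_Icc_self hv)
  have hfi : IntegrableOn f (Ico 0 b) := hf.integrable one_le_two
  have hSi : IntegrableOn S (Ico 0 b) := hSm.integrable one_le_two
  have hfS : IntegrableOn (fun v => f v * conj (S v)) (Ico 0 b) :=
    hf.integrable_mul hSm.star
  have hSS : IntegrableOn (fun v => S v * conj (S v)) (Ico 0 b) :=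
    hSm.integrable_mul hSm.star
  have hff : IntegrableOn (fun v => ‖f v‖ ^ 2) (Ico 0 b) := hf.integrable_norm_pow two_ne_zero
  have h1 := integral_mul_conj_fourierPartialSum hb N f hfi
  have h2 := integral_mul_conj_fourierPartialSum hb N f hSi
  rw [← hS] at h1 h2
  have h3 : ∑ m ∈ Finset.Icc (-(N : ℤ)) N, waveCoeff b S m * conj (waveCoeff b f m)
      = ∑ m ∈ Finset.Icc (-(N : ℤ)) N, waveCoeff b f m * conj (waveCoeff b f m) :=
    Finset.sum_congr rfl fun m hm => by rw [hS, waveCoeff_fourierPartialSum hb N f hm]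
  rw [h3] at h2
  have h4 : ∑ m ∈ Finset.Icc (-(N : ℤ)) N, waveCoeff b f m * conj (waveCoeff b f m)
      = ((∑ m ∈ Finset.Icc (-(N : ℤ)) N, ‖waveCoeff b f m‖ ^ 2 : ℝ) : ℂ) := by
    push_cast
    exact Finset.sum_congr rfl fun m _ => Complex.mul_conj' _
  rw [h4] at h1 h2
  have e : ∀ v, ‖S v - f v‖ ^ 2
      = ‖f v‖ ^ 2 + (S v * conj (S v)).re - 2 * (f v * conj (S v)).re := by
    intro v
    rw [Complex.sq_norm, Complex.sq_norm, Complex.normSq_sub, Complex.mul_conj, Complex.ofReal_re]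
    have : (S v * conj (f v)).re = (f v * conj (S v)).re := by
      rw [← Complex.conj_re (S v * conj (f v)), map_mul, Complex.conj_conj, mul_comm]
    rw [this]; ring
  simp_rw [e]
  have r1 : IntegrableOn (fun v => (f v * conj (S v)).re) (Ico 0 b) := hfS.re
  have r2 : IntegrableOn (fun v => (S v * conj (S v)).re) (Ico 0 b) := hSS.re
  have r3 : IntegrableOn (fun v => ‖f v‖ ^ 2 + (S v * conj (S v)).re) (Ico 0 b) := hff.add r2
  have i1 : ∫ v in Ico 0 b, (f v * conj (S v)).re
      = b * ∑ m ∈ Finset.Icc (-(N : ℤ)) N, ‖waveCoeff b f m‖ ^ 2 := by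
    have := integral_re hfS
    simp only [RCLike.re_to_complex] at this
    rw [this, h1, ← Complex.ofReal_mul, Complex.ofReal_re]
  have i2 : ∫ v in Ico 0 b, (S v * conj (S v)).re
      = b * ∑ m ∈ Finset.Icc (-(N : ℤ)) N, ‖waveCoeff b f m‖ ^ 2 := by
    have := integral_re hSS
    simp only [RCLike.re_to_complex] at this
    rw [this, h2, ← Complex.ofReal_mul, Complex.ofReal_re]
  rw [integral_sub r3 (r1.const_mul 2), integral_add hff r2, integral_const_mul, i1, i2]
  ring

theorem tendsto_Icc_neg_atTop :
    Tendsto (fun N : ℕ => Finset.Icc (-(N : ℤ)) N) atTop atTop := by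
  refine tendsto_atTop_finset_of_monotone ?_ ?_
  · intro M N h
    exact Finset.Icc_subset_Icc (by simpa using h) (by simpa using h)
  · intro m
    refine ⟨m.natAbs, ?_⟩
    rw [Finset.mem_Icc]
    omega

theorem tendsto_sum_waveCoeff_sq {b : ℝ} (hb : 0 < b) {f : ℝ → ℂ}
    (hf : MemLp f 2 (volume.restrict (Ico 0 b))) :
    Tendsto (fun N : ℕ => b * ∑ m ∈ Finset.Icc (-(N : ℤ)) N, ‖waveCoeff b f m‖ ^ 2) atTop
      (𝓝 (∫ v in Ico 0 b, ‖f v‖ ^ 2)) := by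
  have hf' : MemLp f 2 (volume.restrict (Ioc 0 b)) := by
    rwa [restrict_Ico_eq_restrict_Ioc] at hf
  have h := hasSum_sq_fourierCoeffOn hb hf'
  -- The opposite sign convention is harmless, since the sums range over the symmetric interval `|m|
  -- ≤ N`.
  have e : ∀ m, fourierCoeffOn hb f m = waveCoeff b f (-m) := by
    intro m
    rw [fourierCoeffOn_eq_integral]
    unfold waveCoeff
    rw [integral_Ico_eq_integral_Ioc, ← intervalIntegral.integral_of_le hb.le, sub_zero,
      Complex.real_smul]
    congr 1
    · simp
    · congr 1
      ext v
      rw [fourier_coe_apply, smul_eq_mul, mul_comm]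
      rfl
  simp_rw [e] at h
  have h2 := (h.comp tendsto_Icc_neg_atTop).const_mul b
  have e2 : b * ((b - 0)⁻¹ • ∫ x in (0 : ℝ)..b, ‖f x‖ ^ 2) = ∫ v in Ico 0 b, ‖f v‖ ^ 2 := by
    rw [integral_Ico_eq_integral_Ioc, ← intervalIntegral.integral_of_le hb.le, sub_zero, smul_eq_mul]
    field_simp
  rw [e2] at h2
  refine h2.congr fun N => ?_
  simp only [Function.comp]
  rw [sum_Icc_neg_comp_neg (fun m => ‖waveCoeff b f m‖ ^ 2)]

theorem lintegral_enorm_sq_eq_ofReal {α : Type*} [MeasurableSpace α] {μ : Measure α} {f : α → ℂ}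
    (hf : MemLp f 2 μ) : ∫⁻ x, ‖f x‖ₑ ^ 2 ∂μ = ENNReal.ofReal (∫ x, ‖f x‖ ^ 2 ∂μ) := by
  rw [ofReal_integral_eq_lintegral_ofReal (hf.integrable_norm_pow two_ne_zero)
    (ae_of_all _ fun v => by positivity)]
  refine lintegral_congr fun v => ?_
  rw [ENNReal.ofReal_pow (norm_nonneg _), ofReal_norm]

theorem lintegral_enorm_sub_fourierPartialSum_sq {b : ℝ} (hb : 0 < b) (N : ℕ) {f : ℝ → ℂ}
    (hf : MemLp f 2 (volume.restrict (Ico 0 b))) :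
    ∫⁻ v in Ico 0 b, ‖fourierPartialSum b N f v - f v‖ₑ ^ 2
      = ENNReal.ofReal ((∫ v in Ico 0 b, ‖f v‖ ^ 2)
        - b * ∑ m ∈ Finset.Icc (-(N : ℤ)) N, ‖waveCoeff b f m‖ ^ 2) := by
  have hSm : MemLp (fourierPartialSum b N f) 2 (volume.restrict (Ico 0 b)) := by
    have hc := continuous_fourierPartialSum b N f
    obtain ⟨K, hK⟩ := isCompact_Icc.exists_bound_of_continuousOn (s := Icc 0 b) hc.continuousOn
    refine MemLp.of_bound hc.aestronglyMeasurable K ?_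
    filter_upwards [ae_restrict_mem measurableSet_Ico] with v hv
    exact hK v (Ico_subset_Icc_self hv)
  rw [← integral_norm_sub_fourierPartialSum_sq hb N hf]
  exact lintegral_enorm_sq_eq_ofReal (hSm.sub hf)

theorem tendsto_lintegral_enorm_sub_fourierPartialSum {b : ℝ} (hb : 0 < b) {f : ℝ → ℂ}
    (hf : MemLp f 2 (volume.restrict (Ico 0 b))) :
    Tendsto (fun N : ℕ => ∫⁻ v in Ico 0 b, ‖fourierPartialSum b N f v - f v‖ₑ ^ 2) atTop (𝓝 0) := by
  simp_rw [lintegral_enorm_sub_fourierPartialSum_sq hb _ hf]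
  rw [← ENNReal.ofReal_zero]
  refine (ENNReal.continuous_ofReal.tendsto _).comp ?_
  have := (tendsto_sum_waveCoeff_sq hb hf).const_sub (∫ v in Ico 0 b, ‖f v‖ ^ 2)
  rwa [sub_self] at this

/-- A bound independent of `N`: it provides the majorant when slices are integrated over the first
variable. -/
theorem lintegral_enorm_sub_fourierPartialSum_le {b : ℝ} (hb : 0 < b) (N : ℕ) {f : ℝ → ℂ}
    (hf : MemLp f 2 (volume.restrict (Ico 0 b))) :
    ∫⁻ v in Ico 0 b, ‖fourierPartialSum b N f v - f v‖ₑ ^ 2 ≤ ∫⁻ v in Ico 0 b, ‖f v‖ₑ ^ 2 := by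
  rw [lintegral_enorm_sub_fourierPartialSum_sq hb N hf, lintegral_enorm_sq_eq_ofReal hf]
  refine ENNReal.ofReal_le_ofReal (sub_le_self _ ?_)
  positivity

/-! ### Partial Fourier sums in the second variable -/

/-- The Fourier partial sum on `[0, b)` in the second variable. -/
noncomputable def partialSumSnd (b : ℝ) (N : ℕ) (f : ℝ × ℝ → ℂ) (z : ℝ × ℝ) : ℂ :=
  fourierPartialSum b N (fun v => f (z.1, v)) z.2

section

variable {μ : Measure ℝ} {b : ℝ} {f : ℝ × ℝ → ℂ}

theorem aestronglyMeasurable_partialSumSnd (N : ℕ)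
    (hf : AEStronglyMeasurable f (μ.prod (volume.restrict (Ico 0 b)))) :
    AEStronglyMeasurable (partialSumSnd b N f) (μ.prod (volume.restrict (Ico 0 b))) := by
  unfold partialSumSnd fourierPartialSum
  refine AEStronglyMeasurable.const_mul ?_ _
  refine Finset.aestronglyMeasurable_fun_sum _ fun m _ => ?_
  refine AEStronglyMeasurable.mul ?_ ?_
  · exact ((continuous_wave b _).comp continuous_snd).aestronglyMeasurable
  · have h : AEStronglyMeasurable (fun z : ℝ × ℝ => f z * wave b m z.2)
        (μ.prod (volume.restrict (Ico 0 b))) :=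
      hf.mul ((continuous_wave b m).comp continuous_snd).aestronglyMeasurable
    exact h.integral_prod_right'.comp_fst

theorem memLp_two_slice_ae [SFinite μ] (hf : MemLp f 2 (μ.prod (volume.restrict (Ico 0 b)))) :
    ∀ᵐ s ∂μ, MemLp (fun v => f (s, v)) 2 (volume.restrict (Ico 0 b)) := by
  have h1 := (hf.integrable_norm_pow two_ne_zero).prod_right_ae
  have h2 := hf.1.prodMk_left
  filter_upwards [h1, h2] with s hs1 hs2
  exact (memLp_two_iff_integrable_sq_norm hs2).mpr hs1

theorem eLpNorm_two_eq_lintegral {α : Type*} [MeasurableSpace α] (ν : Measure α) (g : α → ℂ) :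
    eLpNorm g 2 ν = (∫⁻ x, ‖g x‖ₑ ^ 2 ∂ν) ^ (1 / 2 : ℝ) := by
  rw [eLpNorm_eq_lintegral_rpow_enorm_toReal two_ne_zero ENNReal.ofNat_ne_top]
  simp

/-- Almost every slice is in `L²`, where its error tends to zero and stays below the energy of the
slice; the latter is integrable over `s` by Tonelli. -/
theorem tendsto_eLpNorm_partialSumSnd [SFinite μ] (hb : 0 < b)
    (hf : MemLp f 2 (μ.prod (volume.restrict (Ico 0 b)))) :
    Tendsto (fun N : ℕ => eLpNorm (fun z => partialSumSnd b N f z - f z) 2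
      (μ.prod (volume.restrict (Ico 0 b)))) atTop (𝓝 0) := by
  have hm : ∀ N, AEMeasurable (fun z => ‖partialSumSnd b N f z - f z‖ₑ ^ 2)
      (μ.prod (volume.restrict (Ico 0 b))) := fun N =>
    ((aestronglyMeasurable_partialSumSnd N hf.1).sub hf.1).enorm.pow_const 2
  have hle : ∀ N s, MemLp (fun v => f (s, v)) 2 (volume.restrict (Ico 0 b)) →
      ∫⁻ v in Ico 0 b, ‖partialSumSnd b N f (s, v) - f (s, v)‖ₑ ^ 2
        ≤ ∫⁻ v in Ico 0 b, ‖f (s, v)‖ₑ ^ 2 := by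
    intro N s hs
    have := lintegral_enorm_sub_fourierPartialSum_le hb N hs
    simpa only [partialSumSnd] using this
  have hlim : ∀ s, MemLp (fun v => f (s, v)) 2 (volume.restrict (Ico 0 b)) →
      Tendsto (fun N => ∫⁻ v in Ico 0 b, ‖partialSumSnd b N f (s, v) - f (s, v)‖ₑ ^ 2)
        atTop (𝓝 0) := by
    intro s hs
    have := tendsto_lintegral_enorm_sub_fourierPartialSum hb hs
    simpa only [partialSumSnd] using this
  have hfin : ∫⁻ s, (∫⁻ v in Ico 0 b, ‖f (s, v)‖ₑ ^ 2) ∂μ ≠ ⊤ := by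
    have e := lintegral_prod (fun z => ‖f z‖ₑ ^ 2) (hf.1.enorm.pow_const 2)
    have e2 := lintegral_enorm_sq_eq_ofReal hf
    exact ne_of_eq_of_ne (e.symm.trans e2) ENNReal.ofReal_ne_top
  have key : Tendsto (fun N : ℕ => ∫⁻ s, (∫⁻ v in Ico 0 b,
      ‖partialSumSnd b N f (s, v) - f (s, v)‖ₑ ^ 2) ∂μ) atTop (𝓝 (∫⁻ _, 0 ∂μ)) := by
    refine tendsto_lintegral_of_dominated_convergence' _ (fun N => (hm N).lintegral_prod_right')
      (fun N => ?_) hfin ?_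
    · filter_upwards [memLp_two_slice_ae hf] with s hs
      exact hle N s hs
    · filter_upwards [memLp_two_slice_ae hf] with s hs
      exact hlim s hs
  rw [lintegral_zero] at key
  have key2 := (ENNReal.continuous_rpow_const (y := 1 / 2)).tendsto 0 |>.comp key
  rw [ENNReal.zero_rpow_of_pos (by norm_num)] at key2
  refine key2.congr fun N => ?_
  rw [eLpNorm_two_eq_lintegral, lintegral_prod _ (hm N)]
  rfl

theorem integrable_partialSumSnd (N : ℕ) (hf : Integrable f (μ.prod (volume.restrict (Ico 0 b)))) :
    Integrable (partialSumSnd b N f) (μ.prod (volume.restrict (Ico 0 b))) := by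
  unfold partialSumSnd fourierPartialSum
  refine Integrable.const_mul ?_ _
  refine integrable_finsetSum _ fun m _ => ?_
  have h : Integrable (fun z : ℝ × ℝ => f z * wave b m z.2) (μ.prod (volume.restrict (Ico 0 b))) :=
    hf.mul_bdd (c := 1) ((continuous_wave b m).comp continuous_snd).aestronglyMeasurable
      (ae_of_all _ fun v => (norm_wave b m _).le)
  have h2 := (h.integral_prod_left).comp_fst (volume.restrict (Ico 0 b))
  exact h2.bdd_mul (c := 1) ((continuous_wave b _).comp continuous_snd).aestronglyMeasurable
    (ae_of_all _ fun v => (norm_wave b _ _).le)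

/-- The Dirichlet kernel is symmetric, so the partial sum operator is its own transpose for the
bilinear pairing; on modes this is the reflection `m ↦ -m`. Boundedness of `g` makes the pairing
meaningful for `f` in `L¹`. -/
theorem integral_partialSumSnd_mul [SFinite μ] (N : ℕ) {g : ℝ × ℝ → ℂ} {K : ℝ}
    (hf : Integrable f (μ.prod (volume.restrict (Ico 0 b))))
    (hg : AEStronglyMeasurable g (μ.prod (volume.restrict (Ico 0 b)))) (hK : ∀ z, ‖g z‖ ≤ K) :
    ∫ z, partialSumSnd b N f z * g z ∂(μ.prod (volume.restrict (Ico 0 b)))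
      = ∫ z, f z * partialSumSnd b N g z ∂(μ.prod (volume.restrict (Ico 0 b))) := by
  set ν : Measure ℝ := volume.restrict (Ico 0 b) with hν
  have hwc : ∀ m, AEStronglyMeasurable (fun z : ℝ × ℝ => wave b m z.2) (μ.prod ν) := fun m =>
    ((continuous_wave b m).comp continuous_snd).aestronglyMeasurable
  have hfw : ∀ m, Integrable (fun z : ℝ × ℝ => f z * wave b m z.2) (μ.prod ν) := fun m =>
    hf.mul_bdd (c := 1) (hwc m) (ae_of_all _ fun v => (norm_wave b m _).le)
  have hgw : ∀ m, AEStronglyMeasurable (fun z : ℝ × ℝ => g z * wave b m z.2) (μ.prod ν) := fun m =>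
    hg.mul (hwc m)
  have hgwK : ∀ m z, ‖g z * wave b m z.2‖ ≤ K := fun m z => by
    rw [norm_mul, norm_wave, mul_one]; exact hK z
  set F : ℤ → ℝ → ℂ := fun m s => ∫ v, f (s, v) * wave b m v ∂ν with hF
  set G : ℤ → ℝ → ℂ := fun m s => ∫ v, g (s, v) * wave b m v ∂ν with hG
  have hFi : ∀ m, Integrable (fun z : ℝ × ℝ => F m z.1) (μ.prod ν) := fun m =>
    (hfw m).integral_prod_left.comp_fst ν
  have hGm : ∀ m, AEStronglyMeasurable (fun z : ℝ × ℝ => G m z.1) (μ.prod ν) := fun m =>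
    (hgw m).integral_prod_right'.comp_fst
  have hGK : ∀ m s, ‖G m s‖ ≤ K * ν.real univ := fun m s =>
    norm_integral_le_of_norm_le_const (ae_of_all _ fun v => hgwK m (s, v))
  have hL : ∀ m, Integrable (fun z : ℝ × ℝ => F m z.1 * (g z * wave b (-m) z.2)) (μ.prod ν) :=
    fun m => (hFi m).mul_bdd (c := K) (hgw _) (ae_of_all _ fun z => hgwK _ z)
  have hR : ∀ m, Integrable (fun z : ℝ × ℝ => G m z.1 * (f z * wave b (-m) z.2)) (μ.prod ν) :=
    fun m => (hfw _).bdd_mul (c := K * ν.real univ) (hGm m) (ae_of_all _ fun z => hGK m z.1)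
  have e1 : ∀ z, partialSumSnd b N f z * g z
      = (b : ℂ)⁻¹ * ∑ m ∈ Finset.Icc (-(N : ℤ)) N, F m z.1 * (g z * wave b (-m) z.2) := by
    intro z
    unfold partialSumSnd fourierPartialSum
    rw [mul_assoc, Finset.sum_mul]
    congr 1
    exact Finset.sum_congr rfl fun m _ => by simp only [hF]; ring
  have e2 : ∀ z, f z * partialSumSnd b N g z
      = (b : ℂ)⁻¹ * ∑ m ∈ Finset.Icc (-(N : ℤ)) N, G m z.1 * (f z * wave b (-m) z.2) := by
    intro z
    unfold partialSumSnd fourierPartialSum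
    rw [mul_left_comm, Finset.mul_sum]
    congr 1
    exact Finset.sum_congr rfl fun m _ => by simp only [hG]; ring
  simp_rw [e1, e2]
  rw [integral_const_mul, integral_const_mul, integral_finsetSum _ fun m _ => hL m,
    integral_finsetSum _ fun m _ => hR m]
  congr 1
  rw [← sum_Icc_neg_comp_neg]
  refine Finset.sum_congr rfl fun m _ => ?_
  rw [integral_prod _ (hL _), integral_prod _ (hR _)]
  refine integral_congr_ae (ae_of_all _ fun s => ?_)
  simp only [integral_const_mul, neg_neg]
  simp only [hF, hG]
  ring

end

/-- As `f` is only integrable, Cauchy–Schwarz is not available. Instead every subsequence has a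
further one along which `h` tends to zero almost everywhere, and `K ‖f‖` dominates. -/
theorem tendsto_integral_mul_of_bounded {α : Type*} [MeasurableSpace α] {μ : Measure α}
    {f : α → ℂ} {h : ℕ → α → ℂ} {K : ℝ} (hf : Integrable f μ)
    (hm : ∀ N, AEStronglyMeasurable (h N) μ) (hK : ∀ N, ∀ᵐ x ∂μ, ‖h N x‖ ≤ K)
    (hlim : Tendsto (fun N => eLpNorm (h N) 2 μ) atTop (𝓝 0)) :
    Tendsto (fun N => ∫ x, f x * h N x ∂μ) atTop (𝓝 0) := by
  refine tendsto_of_subseq_tendsto fun ns hns => ?_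
  have h1 : TendstoInMeasure μ (fun n => h (ns n)) atTop (fun _ => 0) := by
    refine tendstoInMeasure_of_tendsto_eLpNorm two_ne_zero (fun n => hm _)
      aestronglyMeasurable_const ?_
    refine (hlim.comp hns).congr fun n => ?_
    simp only [Function.comp]
    congr 1
    ext x; simp
  obtain ⟨ms, _, hae⟩ := h1.exists_seq_tendsto_ae
  refine ⟨ms, ?_⟩
  rw [← integral_zero α ℂ (μ := μ)]
  refine tendsto_integral_of_dominated_convergence (fun x => ‖f x‖ * K) (fun n => hf.1.mul (hm _))
    (hf.norm.mul_const K) (fun n => ?_) ?_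
  · filter_upwards [hK (ns (ms n))] with x hx
    rw [norm_mul]
    gcongr
  · filter_upwards [hae] with x hx
    simpa using hx.const_mul (f x)

/-- For an integrable `f`, the Fourier partial sums in the second variable converge to `f` when
tested against functions that are `C¹` in the second variable. -/
theorem tendsto_integral_partialSumSnd_mul {μ : Measure ℝ} [IsFiniteMeasure μ] {b : ℝ} (hb : 0 < b)
    {f g g' : ℝ × ℝ → ℂ} {K : ℝ} (hf : Integrable f (μ.prod (volume.restrict (Ico 0 b))))
    (hg : Continuous g) (hg' : Continuous g') (hK : ∀ z, ‖g z‖ ≤ K) (hK' : ∀ z, ‖g' z‖ ≤ K)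
    (hd : ∀ z : ℝ × ℝ, HasDerivAt (fun v => g (z.1, v)) (g' z) z.2) :
    Tendsto (fun N => ∫ z, (partialSumSnd b N f z - f z) * g z
      ∂(μ.prod (volume.restrict (Ico 0 b)))) atTop (𝓝 0) := by
  set ν : Measure ℝ := volume.restrict (Ico 0 b) with hν
  have hgm : AEStronglyMeasurable g (μ.prod ν) := hg.aestronglyMeasurable
  have hg2 : MemLp g 2 (μ.prod ν) := MemLp.of_bound hgm K (ae_of_all _ hK)
  have hSm : ∀ N, AEStronglyMeasurable (partialSumSnd b N g) (μ.prod ν) := fun N =>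
    aestronglyMeasurable_partialSumSnd N hgm
  have hbd : ∀ N, ∀ᵐ z ∂(μ.prod ν), ‖partialSumSnd b N g z‖ ≤ 4 * K * (2 + b) := by
    intro N
    have h1 : ∀ᵐ z ∂(μ.prod ν), z.2 ∈ Ico 0 b :=
      Measure.quasiMeasurePreserving_snd.ae (ae_restrict_mem measurableSet_Ico)
    filter_upwards [h1] with z hz
    exact norm_fourierPartialSum_le hb N (fun v => hd (z.1, v)) (hg'.comp (by fun_prop))
      (fun _ _ => hK _) (fun _ _ => hK' _) (Ico_subset_Icc_self hz)
  have key := tendsto_integral_mul_of_bounded (K := 4 * K * (2 + b) + K) hf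
    (fun N => (hSm N).sub hgm) (fun N => by
      filter_upwards [hbd N] with z hz
      exact (norm_sub_le _ _).trans (add_le_add hz (hK z)))
    (tendsto_eLpNorm_partialSumSnd hb hg2)
  -- The partial sum operator is transposed from `f` to `g`, where the uniform bound and the `L²`
  -- limit are known.
  refine key.congr fun N => ?_
  have i1 := (integrable_partialSumSnd N hf).mul_bdd hgm (ae_of_all _ hK)
  have i2 := hf.mul_bdd hgm (ae_of_all _ hK)
  have i3 := hf.mul_bdd (hSm N) (hbd N)
  simp only [Pi.sub_apply, mul_sub, sub_mul]
  rw [integral_sub i3 i2, integral_sub i1 i2, integral_partialSumSnd_mul N hf hgm hK]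

/-! ### A window whose time-frequency shifts give linearly independent rank one operators -/

/-- With `L = m + r` and `z = 4ζ`, multiplying by `2^m (z - 1)` sums both geometric series and
yields `(2^L - 1)(z^m + 2^L)`. A zero would force `4^m = 2^L` in modulus, which is impossible for
odd `L`. -/
theorem sum_two_pow_ne_zero {m r : ℕ} (hodd : Odd (m + r)) {ζ : ℂ} (hζ : ζ ^ (m + r) = 1) :
    ∑ t ∈ Finset.range m, (2 : ℂ) ^ (t + r) * 2 ^ t * ζ ^ t
      + ∑ s ∈ Finset.range r, (2 : ℂ) ^ s * 2 ^ (m + s) * ζ ^ (m + s) ≠ 0 := by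
  intro h
  set z : ℂ := 4 * ζ with hz
  have h1 : ∑ t ∈ Finset.range m, (2 : ℂ) ^ (t + r) * 2 ^ t * ζ ^ t
      = 2 ^ r * ∑ t ∈ Finset.range m, z ^ t := by
    rw [Finset.mul_sum]
    refine Finset.sum_congr rfl fun t _ => ?_
    rw [hz, mul_pow, show (4 : ℂ) = 2 * 2 by norm_num, mul_pow, pow_add]
    ring
  have h2 : 2 ^ m * ∑ s ∈ Finset.range r, (2 : ℂ) ^ s * 2 ^ (m + s) * ζ ^ (m + s)
      = z ^ m * ∑ s ∈ Finset.range r, z ^ s := by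
    rw [Finset.mul_sum, Finset.mul_sum]
    refine Finset.sum_congr rfl fun t _ => ?_
    rw [hz, mul_pow, mul_pow, show (4 : ℂ) = 2 * 2 by norm_num, mul_pow, mul_pow, pow_add, pow_add]
    ring
  have g1 := geom_sum_mul z m
  have g2 := geom_sum_mul z r
  have hzL : z ^ (m + r) = 2 ^ (m + r) * 2 ^ (m + r) := by
    rw [hz, mul_pow, hζ, mul_one, ← mul_pow]; norm_num
  have key : ((2 : ℂ) ^ (m + r) - 1) * (z ^ m + 2 ^ (m + r)) = 0 := by
    have e : 2 ^ m * (∑ t ∈ Finset.range m, (2 : ℂ) ^ (t + r) * 2 ^ t * ζ ^ t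
      + ∑ s ∈ Finset.range r, (2 : ℂ) ^ s * 2 ^ (m + s) * ζ ^ (m + s)) * (z - 1) = 0 := by
      rw [h]; ring
    rw [mul_add, h1, h2] at e
    rw [pow_add] at hzL ⊢
    linear_combination e - 2 ^ m * 2 ^ r * g1 - z ^ m * g2 - hzL
  have hL : m + r ≠ 0 := by
    rintro h0; rw [h0] at hodd; exact absurd hodd (by decide)
  rcases mul_eq_zero.mp key with h0 | h0
  · have : (2 : ℕ) ^ (m + r) = 1 := by exact_mod_cast sub_eq_zero.mp h0
    exact absurd this (Nat.one_lt_two_pow hL).ne'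
  · have hnorm : ‖ζ‖ = 1 := Complex.norm_eq_one_of_pow_eq_one hζ hL
    have h3 : ‖z ^ m‖ = ‖(2 : ℂ) ^ (m + r)‖ := by
      rw [eq_neg_of_add_eq_zero_left h0, norm_neg]
    rw [norm_pow, norm_pow, hz, norm_mul, hnorm, mul_one] at h3
    have h4 : (2 : ℕ) ^ (2 * m) = 2 ^ (m + r) := by
      rw [pow_mul]
      have h5 : (4 : ℝ) ^ m = 2 ^ (m + r) := by simpa using h3
      exact_mod_cast h5
    have := Nat.pow_right_injective le_rfl h4
    exact (Nat.not_odd_iff_even.mpr ⟨m, by omega⟩) hodd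

theorem sum_zmod_eq_sum_range {L : ℕ} [NeZero L] {M : Type*} [AddCommMonoid M] (f : ZMod L → M) :
    ∑ q, f q = ∑ t ∈ Finset.range L, f (t : ZMod L) := by
  refine (Finset.sum_nbij' (fun t : ℕ => (t : ZMod L)) ZMod.val ?_ ?_ ?_ ?_ ?_).symm
  · simp
  · intro q _; exact Finset.mem_range.mpr q.val_lt
  · intro t ht; exact ZMod.val_cast_of_lt (Finset.mem_range.mp ht)
  · intro q _; exact ZMod.natCast_zmod_val q
  · simp

/-- The window `(1, 2, 4, …, 2 ^ (L - 1))`. -/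
noncomputable def geometricWindow (L : ℕ) (q : ZMod L) : ℂ := 2 ^ q.val

/-- Split the sum at `m = L - r`, where `q + r` wraps around modulo `L`; the two ranges are the two
sums of `sum_two_pow_ne_zero`. -/
theorem ambiguity_geometricWindow_ne_zero {L : ℕ} [NeZero L] (hL : Odd L) (r n : ZMod L) :
    ∑ q : ZMod L, geometricWindow L (q + r) * conj (geometricWindow L q) *
      ZMod.stdAddChar (-(q * n)) ≠ 0 := by
  obtain ⟨m, hm⟩ := Nat.exists_eq_add_of_le' r.val_lt.le
  set ζ : ℂ := ZMod.stdAddChar (-n) with hζ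
  have hchar : ∀ t : ℕ, ZMod.stdAddChar (-((t : ZMod L) * n)) = ζ ^ t := by
    intro t
    rw [hζ, ← AddChar.map_nsmul_eq_pow, nsmul_eq_mul, mul_neg]
  have hζL : ζ ^ (m + r.val) = 1 := by
    rw [← hm, ← hchar]; simp
  have hconj : ∀ t : ℕ, conj ((2 : ℂ) ^ t) = 2 ^ t := by intro t; simp [Complex.conj_ofNat]
  have h := sum_two_pow_ne_zero (hm ▸ hL) hζL
  convert h using 1
  rw [sum_zmod_eq_sum_range, show Finset.range L = Finset.range (m + r.val) by rw [← hm],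
    Finset.sum_range_add]
  congr 1
  · refine Finset.sum_congr rfl fun t ht => ?_
    have ht' := Finset.mem_range.mp ht
    rw [hchar]
    unfold geometricWindow
    rw [ZMod.val_cast_of_lt (by omega), hconj, ZMod.val_add_of_lt, ZMod.val_cast_of_lt (by omega)]
    rw [ZMod.val_cast_of_lt (by omega)]; omega
  · refine Finset.sum_congr rfl fun s hs => ?_
    have hs' := Finset.mem_range.mp hs
    have e : ((m + s : ℕ) : ZMod L) + r = (s : ZMod L) := by
      have : ((m + r.val : ℕ) : ZMod L) = 0 := by rw [← hm]; simp
      rw [Nat.cast_add, ZMod.natCast_zmod_val] at this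
      push_cast
      linear_combination this
    rw [hchar, e]
    unfold geometricWindow
    rw [ZMod.val_cast_of_lt (by omega), ZMod.val_cast_of_lt (by omega), hconj]

-- On the diagonal `p - p' = r` the sum over `l` is a discrete Fourier transform of `X i`, and the
-- sum over `i` is a convolution in `p'` with `q ↦ c (q + r) conj (c q)`. A transform in `p'` turns
-- it into multiplication by the ambiguity function, which can be cancelled; inverting both
-- transforms gives `X = 0`.
open scoped ZMod in
theorem eq_zero_of_sum_shift_eq_zero {L : ℕ} [NeZero L] {c : ZMod L → ℂ}
    (hc : ∀ r n : ZMod L, ∑ q, c (q + r) * conj (c q) * ZMod.stdAddChar (-(q * n)) ≠ 0)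
    {X : ZMod L → ZMod L → ℂ}
    (hX : ∀ p p', ∑ i, ∑ l, X i l * (c (p - i) * conj (c (p' - i)) *
      ZMod.stdAddChar (l * (p - p'))) = 0) (i l : ZMod L) : X i l = 0 := by
  have hY : ∀ r, (fun i => ZMod.dft (X i) (-r)) = 0 := by
    intro r
    rw [← ZMod.dft.map_eq_zero_iff]
    ext n
    have h1 : ∑ p' : ZMod L, ZMod.stdAddChar (-(p' * n)) *
        ∑ i, ZMod.dft (X i) (-r) * (c (p' - i + r) * conj (c (p' - i))) = 0 := by
      refine Finset.sum_eq_zero fun p' _ => ?_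
      convert mul_zero _
      rw [← hX (p' + r) p']
      refine Finset.sum_congr rfl fun i _ => ?_
      rw [ZMod.dft_apply, Finset.sum_mul]
      refine Finset.sum_congr rfl fun l _ => ?_
      rw [smul_eq_mul, mul_neg, neg_neg, add_sub_cancel_left, add_sub_right_comm]
      ring
    have h2 : ∑ p' : ZMod L, ZMod.stdAddChar (-(p' * n)) *
        ∑ i, ZMod.dft (X i) (-r) * (c (p' - i + r) * conj (c (p' - i)))
        = ZMod.dft (fun i => ZMod.dft (X i) (-r)) n *
          ∑ q, c (q + r) * conj (c q) * ZMod.stdAddChar (-(q * n)) := by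
      conv_lhs => simp only [Finset.mul_sum]
      rw [Finset.sum_comm, ZMod.dft_apply, Finset.sum_mul]
      refine Finset.sum_congr rfl fun i _ => ?_
      rw [Finset.mul_sum, ← Equiv.sum_comp (Equiv.addRight i)]
      refine Finset.sum_congr rfl fun q _ => ?_
      rw [Equiv.coe_addRight, add_sub_cancel_right, add_mul, neg_add, AddChar.map_add_eq_mul,
        smul_eq_mul]
      ring
    rw [h2] at h1
    exact (mul_eq_zero.mp h1).resolve_right (hc r n)
  have hXi : X i = 0 := by
    rw [← ZMod.dft.map_eq_zero_iff]
    ext n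
    have := congrFun (hY (-n)) i
    simpa using this
  exact congrFun hXi l

/-- The entry of the matrix `(π(j) c) ⊗ conj (π(j) c)`, where `π(j)` is the time-frequency shift by
`j` on `ℂ^L`. -/
noncomputable def shiftTensor {L : ℕ} (c : ZMod L → ℂ) (p p' : Fin L) (j : Fin L × Fin L) : ℂ :=
  c ((p : ℕ) - (j.1 : ℕ)) * conj (c ((p' : ℕ) - (j.1 : ℕ))) *
    Complex.exp (2 * Real.pi * Complex.I * (j.2 : ℕ) * ((p : ℕ) - (p' : ℕ)) / L)

/-- The array `α` is biorthogonal to the family `(π(j) c) ⊗ conj (π(j) c)`. -/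
def IsDualArray {L : ℕ} (c : ZMod L → ℂ) (α : Fin L × Fin L → Fin L → Fin L → ℂ) : Prop :=
  ∀ j j', ∑ p, ∑ p', α j p p' * shiftTensor c p p' j' = if j = j' then 1 else 0

/-- There are as many shifts `j` as entries `(p, p')`, so linear independence makes a square matrix
invertible; the rows of its inverse are the array. -/
theorem exists_isDualArray {L : ℕ} [NeZero L] {c : ZMod L → ℂ}
    (hc : ∀ r n : ZMod L, ∑ q, c (q + r) * conj (c q) * ZMod.stdAddChar (-(q * n)) ≠ 0) :
    ∃ α, IsDualArray c α := by
  set A : Matrix (Fin L × Fin L) (Fin L × Fin L) ℂ :=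
    Matrix.of fun P j => shiftTensor c P.1 P.2 j with hA
  have hinj : Function.Injective A.mulVec := by
    rw [← Matrix.coe_mulVecLin, injective_iff_map_eq_zero]
    intro x hx
    let e : Fin L ≃ ZMod L :=
      { toFun := fun t => ((t : ℕ) : ZMod L)
        invFun := fun q => ⟨q.val, q.val_lt⟩
        left_inv := fun t => Fin.ext (ZMod.val_cast_of_lt t.2)
        right_inv := fun q => ZMod.natCast_zmod_val q }
    have hX : ∀ i l, x (e.symm i, e.symm l) = 0 := by
      refine eq_zero_of_sum_shift_eq_zero hc fun p p' => ?_
      have h := congrFun hx (e.symm p, e.symm p')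
      rw [Matrix.mulVecLin_apply, Matrix.mulVec_eq_sum] at h
      simp only [Finset.sum_apply, Pi.zero_apply, Pi.smul_apply, Fintype.sum_prod_type] at h
      rw [← h, ← Equiv.sum_comp e]
      refine Finset.sum_congr rfl fun i _ => ?_
      rw [← Equiv.sum_comp e]
      refine Finset.sum_congr rfl fun l _ => ?_
      obtain ⟨p, rfl⟩ := e.surjective p
      obtain ⟨p', rfl⟩ := e.surjective p'
      have h1 : e l * (e p - e p') = (((l : ℕ) * ((p : ℕ) - (p' : ℕ)) : ℤ) : ZMod L) := by
        simp [e]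
      simp only [Equiv.symm_apply_apply, Matrix.transpose_apply, hA, Matrix.of_apply, h1,
        ZMod.stdAddChar_coe, shiftTensor]
      simp only [e, Equiv.coe_fn_mk]
      simp only [MulOpposite.smul_eq_mul_unop, MulOpposite.unop_op]
      push_cast
      rw [mul_comm]
      congr 3
      ring
    ext j
    simpa using hX (e j.1) (e j.2)
  have hu : IsUnit A := Matrix.mulVec_injective_iff_isUnit.mp hinj
  have hu' : A⁻¹ * A = 1 := Matrix.nonsing_inv_mul A ((Matrix.isUnit_iff_isUnit_det A).mp hu)
  refine ⟨fun j p p' => A⁻¹ j (p, p'), fun j j' => ?_⟩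
  have := congrFun (congrFun hu' j) j'
  rw [Matrix.mul_apply, Fintype.sum_prod_type, Matrix.one_apply] at this
  rw [← this]
  rfl

open Classical in
/-- An array biorthogonal to `(π(j) c) ⊗ conj (π(j) c)`, if there is one. -/
noncomputable def dualArray (L : ℕ) (c : ZMod L → ℂ) : Fin L × Fin L → Fin L → Fin L → ℂ :=
  -- The array must be defined for every `c`; the value `0` never occurs for the geometric window
  -- with odd `L`.
  if h : ∃ α, IsDualArray c α then h.choose else 0

theorem isDualArray_dualArray {L : ℕ} (hL : Odd L) :
    IsDualArray (geometricWindow L) (dualArray L (geometricWindow L)) := by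
  have : NeZero L := ⟨by rintro rfl; exact absurd hL (by decide)⟩
  have h := exists_isDualArray (ambiguity_geometricWindow_ne_zero hL)
  rw [dualArray, dif_pos h]
  exact h.choose_spec

/-! ### Distributions carried by the lines `x - x' ∈ aℤ` -/

/-- A real smooth function of compact support as a complex test function. -/
noncomputable def realTestFunction (g : ℝ → ℝ) (hg : ContDiff ℝ ∞ g) (hg' : HasCompactSupport g) :
    𝓓((⊤ : Opens ℝ), ℂ) where
  toFun x := (g x : ℂ)
  contDiff' := Complex.ofRealCLM.contDiff.comp hg
  hasCompactSupport' := hg'.comp_left (g := fun x : ℝ => (x : ℂ)) Complex.ofReal_zero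
  tsupport_subset' _ _ := trivial

theorem realTestFunction_apply (g : ℝ → ℝ) (hg : ContDiff ℝ ∞ g) (hg' : HasCompactSupport g)
    (x : ℝ) : realTestFunction g hg hg' x = (g x : ℂ) := rfl

/-- A line `d'` meeting both supports satisfies `a |d - d'| < a/4 + a/2 < a`, so only `d' = d`
survives; there `ψ` equals `1` on the support of `φ`. -/
theorem IsLineDensity.integral_eq {a : ℝ} (ha : 0 < a)
    {R : 𝓓((⊤ : Opens ℝ), ℂ) → 𝓓((⊤ : Opens ℝ), ℂ) → ℂ} {Φ : ℤ → ℝ → ℂ}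
    (h : IsLineDensity a R Φ) (d : ℤ) (x₀ : ℝ) {φ ψ : 𝓓((⊤ : Opens ℝ), ℂ)}
    (hφ : ∀ x, φ x ≠ 0 → |x - x₀| < a / 4) (hψ : ∀ x, ψ x ≠ 0 → |x - (x₀ - a * d)| < a / 2)
    (hψ1 : ∀ x, |x - (x₀ - a * d)| < a / 4 → ψ x = 1) :
    R φ ψ = ∫ x, Φ d x * φ x := by
  have h1 := h.hasSum φ ψ
  have h2 : ∀ d', d' ≠ d → ∫ x, Φ d' x * (φ x * conj (ψ (x - a * d'))) = 0 := by
    intro d' hd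
    rw [← integral_zero ℝ ℂ]
    congr 1
    ext x
    by_contra hne
    have hx1 := hφ x (by rintro h0; simp [h0] at hne)
    have hx2 := hψ (x - a * d') (by rintro h0; simp [h0] at hne)
    rw [abs_lt] at hx1 hx2
    have i1 : a * (d - d' : ℝ) < a * 1 := by linarith
    have i2 : a * (-1) < a * (d - d' : ℝ) := by linarith
    have j1 := lt_of_mul_lt_mul_left i1 ha.le
    have j2 := lt_of_mul_lt_mul_left i2 ha.le
    have k1 : d - d' < 1 := by exact_mod_cast j1
    have k2 : -1 < d - d' := by exact_mod_cast j2
    omega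
  rw [h1.unique (hasSum_single d h2)]
  congr 1
  ext x
  by_cases hx : φ x = 0
  · simp [hx]
  · rw [hψ1 (x - a * d)]
    · simp
    · convert hφ x hx using 2; ring

/-- The densities of a distribution carried by lines are unique almost everywhere. -/
theorem IsLineDensity.ae_eq {a : ℝ} (ha : 0 < a)
    {R : 𝓓((⊤ : Opens ℝ), ℂ) → 𝓓((⊤ : Opens ℝ), ℂ) → ℂ} {Φ Φ' : ℤ → ℝ → ℂ}
    (h : IsLineDensity a R Φ) (h' : IsLineDensity a R Φ') (d : ℤ) : Φ d =ᵐ[volume] Φ' d := by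
  have hloc := (h.locallyIntegrable d).sub (h'.locallyIntegrable d)
  have key : ∀ x₀ : ℝ, ∀ᵐ x, x ∈ Metric.ball x₀ (a / 4) → (Φ d - Φ' d) x = 0 := by
    intro x₀
    refine Metric.isOpen_ball.ae_eq_zero_of_integral_contDiff_smul_eq_zero
      (hloc.locallyIntegrableOn _) fun g hg hgc hgs => ?_
    -- The radii match `IsLineDensity.integral_eq`, and `g` is an arbitrary test function in the
    -- ball, so the fundamental lemma applies locally.
    let B : ContDiffBump (x₀ - a * d) := ⟨a / 4, a / 2, by positivity, by linarith⟩
    set φ := realTestFunction g hg hgc with hφdef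
    set ψ := realTestFunction B B.contDiff B.hasCompactSupport with hψdef
    have hφ : ∀ x, φ x ≠ 0 → |x - x₀| < a / 4 := by
      intro x hx
      have : x ∈ Metric.ball x₀ (a / 4) := hgs (subset_tsupport _ (by
        rw [Function.mem_support]; rintro h0; exact hx (by simp [hφdef, realTestFunction_apply, h0])))
      simpa [Real.dist_eq] using this
    have hψ : ∀ x, ψ x ≠ 0 → |x - (x₀ - a * d)| < a / 2 := by
      intro x hx
      by_contra! hc
      exact hx (by
        rw [hψdef, realTestFunction_apply, B.zero_of_le_dist (by rw [Real.dist_eq]; exact hc)]; simp)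
    have hψ1 : ∀ x, |x - (x₀ - a * d)| < a / 4 → ψ x = 1 := by
      intro x hx
      rw [hψdef, realTestFunction_apply, B.one_of_mem_closedBall]
      · simp
      · rw [Metric.mem_closedBall, Real.dist_eq]; exact hx.le
    have e := (h.integral_eq ha d x₀ hφ hψ hψ1).symm.trans (h'.integral_eq ha d x₀ hφ hψ hψ1)
    have i : ∀ Φ : ℤ → ℝ → ℂ, LocallyIntegrable (Φ d) → Integrable fun x => g x • Φ d x :=
      fun Φ hΦ => hΦ.integrable_smul_left_of_hasCompactSupport hg.continuous hgc
    simp only [Pi.sub_apply, smul_sub]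
    rw [integral_sub (i Φ (h.locallyIntegrable d)) (i Φ' (h'.locallyIntegrable d)), sub_eq_zero]
    have e2 : ∀ Φ : ℤ → ℝ → ℂ, ∫ x, g x • Φ d x = ∫ x, Φ d x * φ x := by
      intro Φ
      congr 1
      ext x
      rw [hφdef, realTestFunction_apply, Complex.real_smul, mul_comm]
    rw [e2, e2, e]
  rw [Filter.EventuallyEq, ae_iff]
  refine measure_null_of_locally_null _ fun x₀ _ => ?_
  refine ⟨{x | ¬ Φ d x = Φ' d x} ∩ Metric.ball x₀ (a / 4), ?_, ?_⟩
  · exact inter_mem_nhdsWithin _ (Metric.ball_mem_nhds _ (by positivity))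
  · have := ae_iff.mp (key x₀)
    refine measure_mono_null ?_ this
    intro x hx
    simp only [mem_ofPred_eq, Classical.not_imp]
    exact ⟨hx.2, fun h0 => hx.1 (sub_eq_zero.mp h0)⟩

/-! ### The autocorrelation of the response to a delta train -/

/-- The partial Fourier transform `t ↦ ∫ C(t,ν) exp (2πiνy) dν`. -/
noncomputable def partialFourier (C : ℝ × ℝ → ℝ) (y t : ℝ) : ℂ :=
  ∫ ν, (C (t, ν) : ℂ) * Complex.exp (2 * Real.pi * Complex.I * ν * y)

theorem norm_exp_two_pi_I_mul (x y : ℝ) : ‖Complex.exp (2 * Real.pi * Complex.I * x * y)‖ = 1 := by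
  rw [show (2 * Real.pi * Complex.I * x * y : ℂ) = ((2 * Real.pi * x * y : ℝ) : ℂ) * Complex.I by
    push_cast; ring]
  exact Complex.norm_exp_ofReal_mul_I _

theorem integrable_mul_exp {C : ℝ × ℝ → ℝ} (hC : Integrable C) (y : ℝ) :
    Integrable fun z : ℝ × ℝ => (C z : ℂ) * Complex.exp (2 * Real.pi * Complex.I * z.2 * y) :=
  hC.ofReal.mul_bdd (c := 1) (by fun_prop) (ae_of_all _ fun z => (norm_exp_two_pi_I_mul _ _).le)

theorem integrable_partialFourier {C : ℝ × ℝ → ℝ} (hC : Integrable C) (y : ℝ) :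
    Integrable (partialFourier C y) := by
  have := integrable_mul_exp hC y
  rw [Measure.volume_eq_prod] at this
  exact this.integral_prod_left

theorem partialFourier_eq_zero {C : ℝ × ℝ → ℝ} {T : ℝ} (hT : ∀ z, C z ≠ 0 → |z.1| ≤ T) (y : ℝ)
    {t : ℝ} (ht : T < |t|) : partialFourier C y t = 0 := by
  unfold partialFourier
  rw [← integral_zero ℝ ℂ]
  congr 1
  ext ν
  have : C (t, ν) = 0 := by
    by_contra h
    exact absurd (hT _ h) (not_le.mpr ht)
  simp [this]

/-- The density on the line `x - x' = ad` of the autocorrelation of the response to the weighted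
delta train, for an operator with scattering function `C`. -/
noncomputable def responseDensity {L : ℕ} (a : ℝ) (c : ZMod L → ℂ) (C : ℝ × ℝ → ℝ) (d : ℤ)
    (x : ℝ) : ℂ :=
  ∑' k : ℤ, c (k : ZMod L) * conj (c ((k - d : ℤ) : ZMod L)) * partialFourier C (a * d) (x - a * k)

theorem abs_le_of_mem_Icc_neg_of_ne {a : ℝ} (ha : 0 < a) {M T : ℝ} {B : ℕ} (hB : M + T ≤ a * B)
    {k : ℤ} (hk : k ∉ Finset.Icc (-(B : ℤ)) B) {x : ℝ} (hx : |x| ≤ M) : T < |x - a * k| := by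
  have h1 : (B : ℝ) < |(k : ℝ)| := by
    rw [Finset.mem_Icc, ← abs_le, not_le] at hk
    exact_mod_cast hk
  have h2 : |a * k| ≤ |x| + |x - a * k| := by
    have := abs_sub_abs_le_abs_sub (a * k) x
    rw [abs_sub_comm] at this
    linarith
  rw [abs_mul, abs_of_pos ha] at h2
  have := mul_lt_mul_of_pos_left h1 ha
  linarith

section

variable {L : ℕ} {a : ℝ} {c : ZMod L → ℂ} {C : ℝ × ℝ → ℝ} {T : ℝ}

theorem responseDensity_eq_sum (ha : 0 < a) (hT : ∀ z, C z ≠ 0 → |z.1| ≤ T) {M : ℝ} {B : ℕ}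
    (hB : M + T ≤ a * B) (d : ℤ) {x : ℝ} (hx : |x| ≤ M) :
    responseDensity a c C d x = ∑ k ∈ Finset.Icc (-(B : ℤ)) B,
      c (k : ZMod L) * conj (c ((k - d : ℤ) : ZMod L)) *
        partialFourier C (a * d) (x - a * k) := by
  refine tsum_eq_sum fun k hk => ?_
  rw [partialFourier_eq_zero hT _ (abs_le_of_mem_Icc_neg_of_ne ha hB hk hx), mul_zero]

theorem exists_nat_le_mul (ha : 0 < a) (M : ℝ) : ∃ B : ℕ, M ≤ a * B := by
  obtain ⟨B, hB⟩ := exists_nat_ge (M / a)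
  exact ⟨B, by rwa [div_le_iff₀' ha] at hB⟩

theorem locallyIntegrable_responseDensity (ha : 0 < a) (hC : Integrable C)
    (hT : ∀ z, C z ≠ 0 → |z.1| ≤ T) (d : ℤ) : LocallyIntegrable (responseDensity a c C d) := by
  intro x₀
  obtain ⟨B, hB⟩ := exists_nat_le_mul ha (|x₀| + 1 + T)
  have hint : Integrable fun x => ∑ k ∈ Finset.Icc (-(B : ℤ)) B,
      c (k : ZMod L) * conj (c ((k - d : ℤ) : ZMod L)) *
        partialFourier C (a * d) (x - a * k) :=
    integrable_finsetSum _ fun k _ => ((integrable_partialFourier hC _).comp_sub_right _).const_mul _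
  refine ⟨Metric.ball x₀ 1, Metric.ball_mem_nhds _ one_pos, ?_⟩
  refine hint.integrableOn.congr_fun ?_ measurableSet_ball
  intro x hx
  refine (responseDensity_eq_sum ha hT hB d ?_).symm
  rw [Metric.mem_ball, Real.dist_eq] at hx
  have := abs_sub_abs_le_abs_sub x x₀
  linarith

theorem timeFrequencyPairing_deltaTrain_eq_sum (ha : 0 < a) {φ : ℝ → ℂ} {M : ℝ} {B : ℕ}
    (hB : T + M ≤ a * B) (hφ : ∀ x, φ x ≠ 0 → |x| ≤ M) {z : ℝ × ℝ} (hz : |z.1| ≤ T) :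
    timeFrequencyPairing (deltaTrain a c) φ z = ∑ k ∈ Finset.Icc (-(B : ℤ)) B,
      c (k : ZMod L) * (Complex.exp (2 * Real.pi * Complex.I * z.2 * ((a * k : ℝ) + z.1)) *
        φ (a * k + z.1)) := by
  refine tsum_eq_sum fun k hk => ?_
  have h := abs_le_of_mem_Icc_neg_of_ne ha hB hk (x := -z.1) (by rwa [abs_neg])
  have h0 : φ (a * k + z.1) = 0 := by
    by_contra hne
    have := hφ _ hne
    rw [← abs_neg] at this
    exact absurd (lt_of_lt_of_le h (le_of_eq_of_le (by congr 1; ring) this)) (lt_irrefl _)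
  simp only [h0, mul_zero]

/-- In the product of the terms `k` and `k'` the phases combine to `exp(2πiν a(k - k'))`, free of
`t`, so integrating over `ν` produces a partial Fourier transform. -/
theorem integral_pairing_mul_eq_sum (ha : 0 < a) (hC : Integrable C)
    (hT : ∀ z, C z ≠ 0 → |z.1| ≤ T) {φ ψ : ℝ → ℂ} (hφc : Continuous φ) (hψc : Continuous ψ)
    {M : ℝ} {B : ℕ} (hB : T + M ≤ a * B) (hφ : ∀ x, φ x ≠ 0 → |x| ≤ M)
    (hψ : ∀ x, ψ x ≠ 0 → |x| ≤ M) {K : ℝ} (hφK : ∀ x, ‖φ x‖ ≤ K) (hψK : ∀ x, ‖ψ x‖ ≤ K) :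
    ∫ z, (C z : ℂ) * (timeFrequencyPairing (deltaTrain a c) φ z *
      conj (timeFrequencyPairing (deltaTrain a c) ψ z))
      = ∑ k ∈ Finset.Icc (-(B : ℤ)) B, ∑ k' ∈ Finset.Icc (-(B : ℤ)) B,
        c (k : ZMod L) * conj (c (k' : ZMod L)) *
          ∫ x, partialFourier C (a * (k - k' : ℤ)) (x - a * k) *
            (φ x * conj (ψ (x - a * (k - k' : ℤ)))) := by
  set s := Finset.Icc (-(B : ℤ)) B with hs
  have e : ∀ z : ℝ × ℝ, (C z : ℂ) * (timeFrequencyPairing (deltaTrain a c) φ z *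
      conj (timeFrequencyPairing (deltaTrain a c) ψ z))
      = ∑ k ∈ s, ∑ k' ∈ s, c (k : ZMod L) * conj (c (k' : ZMod L)) *
        ((C z : ℂ) * Complex.exp (2 * Real.pi * Complex.I * z.2 * (a * (k - k' : ℤ) : ℝ)) *
          (φ (a * k + z.1) * conj (ψ (a * k' + z.1)))) := by
    intro z
    by_cases hz : C z = 0
    · simp [hz]
    have hz' := hT z hz
    rw [timeFrequencyPairing_deltaTrain_eq_sum ha hB hφ hz',
      timeFrequencyPairing_deltaTrain_eq_sum ha hB hψ hz', map_sum, Finset.sum_mul_sum,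
      Finset.mul_sum]
    refine Finset.sum_congr rfl fun k _ => ?_
    rw [Finset.mul_sum]
    refine Finset.sum_congr rfl fun k' _ => ?_
    rw [map_mul, map_mul, ← Complex.exp_conj]
    have e1 : Complex.exp (2 * Real.pi * Complex.I * z.2 * (a * (k - k' : ℤ) : ℝ))
        = Complex.exp (2 * Real.pi * Complex.I * z.2 * ((a * k : ℝ) + z.1)) *
          Complex.exp (conj (2 * Real.pi * Complex.I * z.2 * ((a * k' : ℝ) + z.1))) := by
      rw [← Complex.exp_add]
      congr 1
      simp [Complex.conj_ofNat]
      ring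
    rw [e1]
    ring
  have hi : ∀ k k' : ℤ, Integrable fun z : ℝ × ℝ =>
      (C z : ℂ) * Complex.exp (2 * Real.pi * Complex.I * z.2 * (a * (k - k' : ℤ) : ℝ)) *
          (φ (a * k + z.1) * conj (ψ (a * k' + z.1))) := by
    intro k k'
    refine (integrable_mul_exp hC _).mul_bdd (c := K * K) ?_ (ae_of_all _ fun z => ?_)
    · refine Continuous.aestronglyMeasurable ?_
      exact (hφc.comp (by fun_prop)).mul (Complex.continuous_conj.comp (hψc.comp (by fun_prop)))
    · rw [norm_mul, RCLike.norm_conj]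
      exact mul_le_mul (hφK _) (hψK _) (norm_nonneg _) ((norm_nonneg _).trans (hφK 0))
  simp_rw [e]
  rw [integral_finsetSum _ fun k _ => integrable_finsetSum _ fun k' _ => (hi k k').const_mul _]
  refine Finset.sum_congr rfl fun k _ => ?_
  rw [integral_finsetSum _ fun k' _ => (hi k k').const_mul _]
  refine Finset.sum_congr rfl fun k' _ => ?_
  rw [integral_const_mul]
  congr 1
  have h1 := hi k k'
  rw [Measure.volume_eq_prod] at h1 ⊢
  rw [integral_prod _ h1]
  simp only [integral_mul_const]
  -- The substitution `x = ak + t` turns the arguments of `φ` and `ψ` into `x` and `x - a(k - k')`.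
  rw [← integral_sub_right_eq_self _ (a * (k : ℝ))]
  congr 1
  ext x
  unfold partialFourier
  have e1 : a * (k : ℝ) + (x - a * k) = x := by ring
  have e2 : a * (k' : ℝ) + (x - a * k) = x - a * (k - k' : ℤ) := by push_cast; ring
  rw [e1, e2]

theorem hasSum_responseDensity (ha : 0 < a) (hC : Integrable C)
    (hT : ∀ z, C z ≠ 0 → |z.1| ≤ T) {φ ψ : ℝ → ℂ} (hφc : Continuous φ) (hψc : Continuous ψ)
    {M : ℝ} (hφ : ∀ x, φ x ≠ 0 → |x| ≤ M) (hψ : ∀ x, ψ x ≠ 0 → |x| ≤ M)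
    {K : ℝ} (hφK : ∀ x, ‖φ x‖ ≤ K) (hψK : ∀ x, ‖ψ x‖ ≤ K) :
    HasSum (fun d : ℤ => ∫ x, responseDensity a c C d x * (φ x * conj (ψ (x - a * d))))
      (∫ z, (C z : ℂ) * (timeFrequencyPairing (deltaTrain a c) φ z *
        conj (timeFrequencyPairing (deltaTrain a c) ψ z))) := by
  obtain ⟨B, hB⟩ := exists_nat_le_mul ha (T + M)
  rw [integral_pairing_mul_eq_sum ha hC hT hφc hψc hB hφ hψ hφK hψK]
  set s := Finset.Icc (-(B : ℤ)) B with hs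
  have hi : ∀ k d : ℤ, Integrable fun x =>
      partialFourier C (a * d) (x - a * k) * (φ x * conj (ψ (x - a * d))) := by
    intro k d
    refine ((integrable_partialFourier hC _).comp_sub_right _).mul_bdd (c := K * K) ?_
      (ae_of_all _ fun x => ?_)
    · refine Continuous.aestronglyMeasurable ?_
      exact hφc.mul (Complex.continuous_conj.comp (hψc.comp (by fun_prop)))
    · rw [norm_mul, RCLike.norm_conj]
      exact mul_le_mul (hφK _) (hψK _) (norm_nonneg _) ((norm_nonneg _).trans (hφK 0))
  have e : ∀ d : ℤ, ∫ x, responseDensity a c C d x * (φ x * conj (ψ (x - a * d)))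
      = ∑ k ∈ s, c (k : ZMod L) * conj (c ((k - d : ℤ) : ZMod L)) *
        ∫ x, partialFourier C (a * d) (x - a * k) * (φ x * conj (ψ (x - a * d))) := by
    intro d
    simp_rw [← integral_const_mul]
    rw [← integral_finsetSum _ fun k _ => (hi k d).const_mul _]
    congr 1
    ext x
    by_cases hx : φ x = 0
    · simp [hx]
    rw [responseDensity_eq_sum ha hT (add_comm T M ▸ hB) d (hφ x hx), Finset.sum_mul]
    exact Finset.sum_congr rfl fun k _ => by ring
  simp_rw [e]
  refine hasSum_sum fun k _ => ?_
  -- For fixed `k`, regroup by `d = k - k'`; the sum over `k'` is finite because the supports of `C`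
  -- and `ψ` exclude large `k'`.
  rw [← (Equiv.subLeft k).hasSum_iff]
  have e2 : ((fun d : ℤ => c (k : ZMod L) * conj (c ((k - d : ℤ) : ZMod L)) *
        ∫ x, partialFourier C (a * d) (x - a * k) * (φ x * conj (ψ (x - a * d)))) ∘
        (Equiv.subLeft k)) = fun k' : ℤ => c (k : ZMod L) * conj (c (k' : ZMod L)) *
          ∫ x, partialFourier C (a * (k - k' : ℤ)) (x - a * k) *
            (φ x * conj (ψ (x - a * (k - k' : ℤ)))) := by
    ext k'
    simp only [Function.comp, Equiv.subLeft_apply, sub_sub_cancel]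
  rw [e2]
  refine hasSum_sum_of_ne_finset_zero fun k' hk' => ?_
  convert mul_zero _
  rw [← integral_zero ℝ ℂ]
  congr 1
  ext x
  by_contra hne
  have h1 : |x - a * k| ≤ T := by
    by_contra! hc
    exact hne (by rw [partialFourier_eq_zero hT _ hc, zero_mul])
  have h2 := hψ (x - a * (k - k' : ℤ)) (by
    rintro h0; exact hne (by rw [h0, map_zero, mul_zero, mul_zero]))
  have h3 := abs_le_of_mem_Icc_neg_of_ne ha hB hk' (x := -(x - a * k)) (by rwa [abs_neg])
  rw [← abs_neg] at h2
  refine absurd (lt_of_lt_of_le h3 (le_of_eq_of_le ?_ h2)) (lt_irrefl _)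
  congr 1
  push_cast; ring

/-- The covariance sees the spreading function only through integrals against `C`, so a cutoff equal
to `1` where `C ≠ 0` leaves no trace. -/
theorem isLineDensity_responseDensity {Ω : Type*} [MeasurableSpace Ω] {P : Measure Ω}
    {H : StochasticOperator P} (hH : IsWSSUS H C) (ha : 0 < a) (hC : Integrable C)
    (hT : ∀ z, C z ≠ 0 → |z.1| ≤ T) {χ : 𝓓((⊤ : Opens (ℝ × ℝ)), ℂ)}
    (hχ : ∀ z, C z ≠ 0 → χ z = 1) :
    IsLineDensity a (autocorrelation (H.response χ (deltaTrain a c))) (responseDensity a c C) := by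
  refine ⟨locallyIntegrable_responseDensity ha hC hT, fun φ ψ => ?_⟩
  have e : autocorrelation (H.response χ (deltaTrain a c)) φ ψ
      = ∫ z, (C z : ℂ) * (timeFrequencyPairing (deltaTrain a c) φ z *
        conj (timeFrequencyPairing (deltaTrain a c) ψ z)) := by
    unfold autocorrelation
    rw [H.response_deltaTrain χ ha.ne', H.response_deltaTrain χ ha.ne', hH.autocorrelation_eq]
    congr 1
    ext z
    by_cases hz : C z = 0
    · simp [hz]
    · change (C z : ℂ) * ((χ z * _) * conj (χ z * _)) = _
      rw [hχ z hz, one_mul, one_mul]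
  rw [e]
  have hb : ∀ θ : 𝓓((⊤ : Opens ℝ), ℂ), ∃ M K : ℝ, (∀ x, θ x ≠ 0 → |x| ≤ M) ∧ ∀ x, ‖θ x‖ ≤ K := by
    intro θ
    obtain ⟨M, hM⟩ := θ.hasCompactSupport.isCompact.isBounded.exists_norm_le
    obtain ⟨K, hK⟩ := θ.hasCompactSupport.exists_bound_of_continuous θ.continuous
    exact ⟨M, K, fun x hx => hM x (subset_tsupport _ hx), hK⟩
  obtain ⟨M₁, K₁, h1, h1'⟩ := hb φ
  obtain ⟨M₂, K₂, h2, h2'⟩ := hb ψ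
  exact hasSum_responseDensity ha hC hT φ.continuous ψ.continuous
    (fun x hx => (h1 x hx).trans (le_max_left M₁ M₂))
    (fun x hx => (h2 x hx).trans (le_max_right M₁ M₂))
    (fun x => (h1' x).trans (le_max_left K₁ K₂)) (fun x => (h2' x).trans (le_max_right K₁ K₂))

end

/-! ### The reconstruction formula on a single rectangle -/

/-- A function supported in disjoint translates of `B` is the sum of its pieces. -/
theorem sum_indicator_translate {G ι M : Type*} [AddGroup G] [Fintype ι] [AddCommMonoid M]
    {B : Set G} {τ : ι → G} (huniq : ∀ z j j', z - τ j ∈ B → z - τ j' ∈ B → j = j') {f : G → M}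
    (hf : ∀ z, f z ≠ 0 → ∃ j, z - τ j ∈ B) (z : G) :
    ∑ j, B.indicator (fun w => f (w + τ j)) (z - τ j) = f z := by
  by_cases h : ∃ j, z - τ j ∈ B
  · obtain ⟨j, hj⟩ := h
    rw [Finset.sum_eq_single j, indicator_of_mem hj, sub_add_cancel]
    · intro j' _ hne
      exact indicator_of_notMem (fun h' => hne (huniq z j' j h' hj)) _
    · exact fun h' => absurd (Finset.mem_univ j) h'
  · have h0 : f z = 0 := by
      by_contra hne
      exact h (hf z hne)
    rw [h0]
    refine Finset.sum_eq_zero fun j _ => indicator_of_notMem (fun hj => h ⟨j, hj⟩) _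

theorem eq_of_sub_mul_mem_Ico {b : ℝ} (hb : 0 < b) {x : ℝ} {k k' : ℤ} (h : x - b * k ∈ Ico 0 b)
    (h' : x - b * k' ∈ Ico 0 b) : k = k' := by
  have i1 : b * (k - k' : ℝ) < b * 1 := by linarith [h.1, h'.2]
  have i2 : b * (-1) < b * (k - k' : ℝ) := by linarith [h.2, h'.1]
  have j1 := lt_of_mul_lt_mul_left i1 hb.le
  have j2 := lt_of_mul_lt_mul_left i2 hb.le
  have k1 : k - k' < 1 := by exact_mod_cast j1
  have k2 : -1 < k - k' := by exact_mod_cast j2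
  omega

/-- The function `C` is supported in the rectangles `[0,a) × [0,b) + (a κ i, b κ l)`. -/
def IsTiled {L : ℕ} (a b : ℝ) (κ : Fin L → ℤ) (C : ℝ × ℝ → ℝ) : Prop :=
  ∀ z, C z ≠ 0 → ∃ j : Fin L × Fin L, z - (a * κ j.1, b * κ j.2) ∈ prototypeBox a b

/-- The piece of `C` on the rectangle with index `j`, translated to the origin. -/
noncomputable def tilePiece {L : ℕ} (a b : ℝ) (κ : Fin L → ℤ) (C : ℝ × ℝ → ℝ) (j : Fin L × Fin L)
    (z : ℝ × ℝ) : ℂ :=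
  (C (z + (a * κ j.1, b * κ j.2)) : ℂ)

/-- The modulation `exp (2πi a (p - p') w)`. -/
noncomputable def phase {L : ℕ} (a : ℝ) (p p' : Fin L) (w : ℝ) : ℂ :=
  Complex.exp (2 * Real.pi * Complex.I * w * (a * ((p : ℕ) - (p' : ℕ))))

section

variable {L : ℕ} {a b : ℝ} {c : ZMod L → ℂ} {C : ℝ × ℝ → ℝ} {κ : Fin L → ℤ}

theorem partialFourier_eq_sum (hb : 0 < b) (hκ : Function.Injective κ) (hC : IsTiled a b κ C)
    {t : ℝ} (ht : Integrable fun ν => C (t, ν)) (y : ℝ) :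
    partialFourier C y t = ∑ l, ∫ v in Ico 0 b, (C (t, v + b * κ l) : ℂ) *
      Complex.exp (2 * Real.pi * Complex.I * (v + b * κ l : ℝ) * y) := by
  set h : ℝ → ℂ := fun ν => (C (t, ν) : ℂ) * Complex.exp (2 * Real.pi * Complex.I * ν * y) with hh
  have hi : Integrable h :=
    ht.ofReal.mul_bdd (c := 1) (by fun_prop) (ae_of_all _ fun z => (norm_exp_two_pi_I_mul _ _).le)
  have e : ∀ ν, h ν = ∑ l, (Ico 0 b).indicator (fun v => h (v + b * κ l)) (ν - b * κ l) := by
    intro ν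
    refine (sum_indicator_translate (τ := fun l => b * (κ l : ℝ)) ?_ ?_ ν).symm
    · exact fun z l l' hl hl' => hκ (eq_of_sub_mul_mem_Ico hb hl hl')
    · intro ν hν
      obtain ⟨j, hj⟩ := hC (t, ν) (by rintro h0; exact hν (by simp [hh, h0]))
      exact ⟨j.2, hj.2⟩
  unfold partialFourier
  refine (integral_congr_ae (ae_of_all _ e)).trans ?_
  rw [integral_finsetSum]
  · refine Finset.sum_congr rfl fun l _ => ?_
    rw [integral_sub_right_eq_self (fun ν => (Ico 0 b).indicator (fun v => h (v + b * κ l)) ν),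
      integral_indicator measurableSet_Ico]
  · exact fun l _ => ((hi.comp_add_right _).indicator measurableSet_Ico).comp_sub_right _

/-- If `s + ap - ak` lies in column `i`, then `s` and `s + a(p - k - κ i)` are both in `[0,a)`,
forcing `k = p - κ i`. -/
theorem responseDensity_eq_sum_tiles (ha : 0 < a) (hκ : Function.Injective κ)
    (hC : IsTiled a b κ C) {s : ℝ} (hs : s ∈ Ico 0 a) (p d : ℤ) :
    responseDensity a c C d (s + a * p) = ∑ i, c ((p - κ i : ℤ) : ZMod L) *
      conj (c ((p - κ i - d : ℤ) : ZMod L)) * partialFourier C (a * d) (s + a * κ i) := by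
  have hinj : Function.Injective fun i => p - κ i := fun i i' h => hκ (sub_right_injective h)
  unfold responseDensity
  rw [← hinj.tsum_eq, tsum_fintype]
  · refine Finset.sum_congr rfl fun i _ => ?_
    congr 2
    push_cast; ring
  · intro k hk
    have hne : partialFourier C (a * d) (s + a * p - a * k) ≠ 0 := right_ne_zero_of_mul hk
    have : ∃ ν, C (s + a * p - a * k, ν) ≠ 0 := by
      by_contra! h0
      exact hne (by simp [partialFourier, h0])
    obtain ⟨ν, hν⟩ := this
    obtain ⟨j, hj⟩ := hC _ hν
    refine ⟨j.1, ?_⟩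
    have h1 : s + a * p - a * k - a * κ j.1 ∈ Ico 0 a := hj.1
    have h2 : s + a * (p - k : ℤ) - a * (κ j.1) ∈ Ico 0 a := by
      convert h1 using 1; push_cast; ring
    have h3 : s + a * (p - k : ℤ) - a * (p - k : ℤ) ∈ Ico 0 a := by rwa [add_sub_cancel_right]
    have := eq_of_sub_mul_mem_Ico ha h2 h3
    simp only
    omega

theorem exp_mul_responseDensity_eq (ha : 0 < a) (hb : 0 < b) (hab : a * b * L = 1)
    (hκ : Function.Injective κ) (hκL : ∀ i, ((κ i : ℤ) : ZMod L) = ((i : ℕ) : ZMod L))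
    (hC : IsTiled a b κ C) {s : ℝ} (hs : s ∈ Ico 0 a)
    (hslice : ∀ i, Integrable fun ν => C (s + a * κ i, ν)) (p p' : Fin L) (m n : ℤ) (w : ℝ) :
    Complex.exp (-(2 * Real.pi * Complex.I * a *
        (((p : ℕ) - (p' : ℕ) : ℂ) * w + (w + b * n : ℝ) * m * L))) *
      responseDensity a c C ((p : ℕ) - (p' : ℕ) + m * L) (s + a * (p : ℕ))
    = ∑ j, shiftTensor c p p' j * (phase a p p' (-w) * (wave b (-m) w *
        ∫ v in Ico 0 b, tilePiece a b κ C j (s, v) * phase a p p' v * wave b m v)) := by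
  have hL : (L : ℂ) ≠ 0 := by
    rintro h0
    rw [show (L : ℝ) = 0 by exact_mod_cast h0] at hab
    simp at hab
  have hbC : (b : ℂ) ≠ 0 := by exact_mod_cast hb.ne'
  have haC : (a : ℂ) = 1 / (b * L) := by
    rw [eq_div_iff (mul_ne_zero hbC hL), ← mul_assoc]; exact_mod_cast hab
  have h1 : Complex.exp (-(2 * Real.pi * Complex.I * a *
        (((p : ℕ) - (p' : ℕ) : ℂ) * w + (w + b * n : ℝ) * m * L)))
      = phase a p p' (-w) * wave b (-m) w := by
    unfold phase wave
    rw [← Complex.exp_add, Complex.exp_eq_exp_iff_exists_int]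
    -- Since `aL = 1/b`, the offset `bn` of the tile contributes only the integer phase `-nm`.
    refine ⟨-(n * m), ?_⟩
    rw [haC]
    push_cast
    field_simp
    ring
  have h2 := responseDensity_eq_sum_tiles (c := c) ha hκ hC hs (p : ℕ)
    ((p : ℕ) - (p' : ℕ) + m * L)
  rw [h1]
  have hp : ((((p : ℕ) : ℤ)) : ℝ) = ((p : ℕ) : ℝ) := by push_cast; rfl
  rw [hp] at h2
  rw [h2, Fintype.sum_prod_type, Finset.mul_sum]
  refine Finset.sum_congr rfl fun i _ => ?_
  have c1 : (((p : ℕ) - κ i : ℤ) : ZMod L) = (p : ℕ) - ((i : ℕ) : ZMod L) := by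
    push_cast; rw [hκL]
  have c2 : (((p : ℕ) - κ i - ((p : ℕ) - (p' : ℕ) + m * L) : ℤ) : ZMod L)
      = (p' : ℕ) - ((i : ℕ) : ZMod L) := by
    push_cast; rw [hκL, ZMod.natCast_self]; ring
  rw [c1, c2, partialFourier_eq_sum hb hκ hC (hslice i), Finset.mul_sum, Finset.mul_sum]
  refine Finset.sum_congr rfl fun l _ => ?_
  obtain ⟨r, hr⟩ : ∃ r : ℤ, κ l = (l : ℕ) + L * r := by
    have := hκL l
    rw [← Int.cast_natCast, ZMod.intCast_eq_intCast_iff_dvd_sub] at this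
    obtain ⟨r, hr⟩ := this
    exact ⟨-r, by rw [mul_neg, ← hr]; ring⟩
  have h3 : ∀ v : ℝ, (C (s + a * κ i, v + b * κ l) : ℂ) * Complex.exp (2 * Real.pi * Complex.I *
        (v + b * κ l : ℝ) * (a * ((p : ℕ) - (p' : ℕ) + m * L : ℤ) : ℝ))
      = Complex.exp (2 * Real.pi * Complex.I * (l : ℕ) * ((p : ℕ) - (p' : ℕ)) / L) *
        (tilePiece a b κ C (i, l) (s, v) * phase a p p' v * wave b m v) := by
    intro v
    have h4 : Complex.exp (2 * Real.pi * Complex.I *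
        (v + b * κ l : ℝ) * (a * ((p : ℕ) - (p' : ℕ) + m * L : ℤ) : ℝ))
        = Complex.exp (2 * Real.pi * Complex.I * (l : ℕ) * ((p : ℕ) - (p' : ℕ)) / L) *
          (phase a p p' v * wave b m v) := by
      unfold phase wave
      rw [← Complex.exp_add, ← Complex.exp_add, Complex.exp_eq_exp_iff_exists_int]
      -- The row offset `bκ_l` contributes `κ_l (p - p')/L + κ_l m` turns; writing `κ_l = l + Lr`,
      -- all but `l(p - p')/L` is an integer.
      refine ⟨r * ((p : ℕ) - (p' : ℕ)) + κ l * m, ?_⟩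
      rw [hr]
      push_cast
      rw [haC]
      field_simp
      ring
    rw [h4]
    unfold tilePiece
    rw [Prod.mk_add_mk]
    ring
  simp_rw [h3]
  rw [integral_const_mul]
  unfold shiftTensor
  ring

/-- The difference between the partial reconstruction and `C` on the rectangle with index `j`,
translated to the origin. -/
noncomputable def tileError (a b : ℝ) (κ : Fin L → ℤ) (c : ZMod L → ℂ)
    (α : Fin L × Fin L → Fin L → Fin L → ℂ) (C : ℝ × ℝ → ℝ) (N : ℕ) (j : Fin L × Fin L)
    (z : ℝ × ℝ) : ℂ :=
  ∑ p, ∑ p', ∑ j', α j p p' * shiftTensor c p p' j' * (phase a p p' (-z.2) *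
    (partialSumSnd b N (fun z => tilePiece a b κ C j' z * phase a p p' z.2) z -
      tilePiece a b κ C j' z * phase a p p' z.2))

/-- Biorthogonality expresses `C` by the same finite sum as the reconstruction, with each Fourier
partial sum replaced by the function it approximates; subtracting leaves only Fourier errors. -/
theorem reconstruction_sub_eq_tileError (ha : 0 < a) (hb : 0 < b) (hab : a * b * L = 1)
    (hκ : Function.Injective κ) (hκL : ∀ i, ((κ i : ℤ) : ZMod L) = ((i : ℕ) : ZMod L))
    {α : Fin L × Fin L → Fin L → Fin L → ℂ} (hα : IsDualArray c α)
    (hC : IsTiled a b κ C) {z : ℝ × ℝ} (hz : z ∈ prototypeBox a b)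
    (hslice : ∀ i, Integrable fun ν => C (z.1 + a * κ i, ν)) (j : Fin L × Fin L) (N : ℕ) :
    reconstruction a b α (fun j => κ j.1) (fun j => κ j.2) (responseDensity a c C) N
        (z + (a * κ j.1, b * κ j.2)) - (C (z + (a * κ j.1, b * κ j.2)) : ℂ)
      = tileError a b κ c α C N j z := by
  obtain ⟨s, w⟩ := z
  have hrec : reconstruction a b α (fun j => κ j.1) (fun j => κ j.2) (responseDensity a c C) N
        ((s, w) + (a * κ j.1, b * κ j.2))
      = ∑ p, ∑ p', ∑ j', α j p p' * shiftTensor c p p' j' * (phase a p p' (-w) *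
        partialSumSnd b N (fun z => tilePiece a b κ C j' z * phase a p p' z.2) (s, w)) := by
    unfold reconstruction
    rw [Finset.sum_eq_single j]
    · simp only [Prod.mk_add_mk, add_sub_cancel_right]
      rw [indicator_of_mem hz, one_mul, Finset.mul_sum]
      refine Finset.sum_congr rfl fun p _ => ?_
      rw [Finset.mul_sum]
      refine Finset.sum_congr rfl fun p' _ => ?_
      have hx : s + a * κ j.1 - a * (κ j.1 - (p : ℕ)) = s + a * (p : ℕ) := by ring
      have hy : ((w + b * κ j.2 : ℝ) : ℂ) - b * κ j.2 = w := by push_cast; ring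
      simp_rw [hx, hy, mul_assoc (α j p p')]
      simp_rw [exp_mul_responseDensity_eq (c := c) ha hb hab hκ hκL hC hz.1 hslice p p' _ (κ j.2) w]
      rw [← Finset.mul_sum, Finset.sum_comm, mul_left_comm, ← Finset.mul_sum, Finset.mul_sum]
      congr 1
      refine Finset.sum_congr rfl fun j' _ => ?_
      unfold partialSumSnd fourierPartialSum
      rw [← Finset.mul_sum, ← Finset.mul_sum]
      ring
    · intro j' _ hne
      rw [indicator_of_notMem, zero_mul]
      intro hmem
      refine hne (Prod.ext ?_ ?_)
      · refine hκ (eq_of_sub_mul_mem_Ico ha (x := s + a * κ j.1) hmem.1 ?_)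
        rw [add_sub_cancel_right]; exact hz.1
      · refine hκ (eq_of_sub_mul_mem_Ico hb (x := w + b * κ j.2) hmem.2 ?_)
        rw [add_sub_cancel_right]; exact hz.2
    · exact fun h => absurd (Finset.mem_univ j) h
  have hphase : ∀ p p' : Fin L, phase a p p' (-w) * phase a p p' w = 1 := by
    intro p p'
    unfold phase
    rw [← Complex.exp_add, Complex.exp_eq_one_iff]
    exact ⟨0, by push_cast; ring⟩
  have hdual : (C ((s, w) + (a * κ j.1, b * κ j.2)) : ℂ)
      = ∑ p, ∑ p', ∑ j', α j p p' * shiftTensor c p p' j' * (phase a p p' (-w) *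
        (tilePiece a b κ C j' (s, w) * phase a p p' w)) := by
    have e : ∀ p p' j', α j p p' * shiftTensor c p p' j' * (phase a p p' (-w) *
        (tilePiece a b κ C j' (s, w) * phase a p p' w))
        = α j p p' * shiftTensor c p p' j' * tilePiece a b κ C j' (s, w) := by
      intro p p' j'
      linear_combination α j p p' * shiftTensor c p p' j' * tilePiece a b κ C j' (s, w) *
        hphase p p'
    simp_rw [e]
    have e2 : ∀ p, ∑ p', ∑ j', α j p p' * shiftTensor c p p' j' * tilePiece a b κ C j' (s, w)
        = ∑ j', ∑ p', α j p p' * shiftTensor c p p' j' * tilePiece a b κ C j' (s, w) :=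
      fun p => Finset.sum_comm
    simp_rw [e2]
    rw [Finset.sum_comm]
    simp_rw [← Finset.sum_mul, hα j]
    simp [tilePiece]
  rw [hrec, hdual]
  unfold tileError
  simp_rw [mul_sub, Finset.sum_sub_distrib]

end

/-! ### Convergence of the partial reconstructions -/

theorem norm_phase {L : ℕ} (a : ℝ) (p p' : Fin L) (w : ℝ) : ‖phase a p p' w‖ = 1 := by
  unfold phase
  have := norm_exp_two_pi_I_mul w (a * ((p : ℕ) - (p' : ℕ)))
  push_cast at this
  exact this

theorem contDiff_phase {L : ℕ} (a : ℝ) (p p' : Fin L) : ContDiff ℝ ∞ (phase a p p') := by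
  unfold phase
  exact ((contDiff_const.mul Complex.ofRealCLM.contDiff).mul contDiff_const).cexp

theorem tendsto_eLpNorm_finset_sum {α ι : Type*} [MeasurableSpace α] {μ : Measure α}
    {f : ι → ℕ → α → ℂ} (s : Finset ι) (hm : ∀ i N, AEStronglyMeasurable (f i N) μ)
    (hf : ∀ i, Tendsto (fun N => eLpNorm (f i N) 2 μ) atTop (𝓝 0)) :
    Tendsto (fun N => eLpNorm (fun x => ∑ i ∈ s, f i N x) 2 μ) atTop (𝓝 0) := by
  have h := tendsto_finsetSum s fun i _ => hf i
  rw [Finset.sum_const_zero] at h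
  refine tendsto_of_tendsto_of_tendsto_of_le_of_le tendsto_const_nhds h (fun _ => zero_le) fun N => ?_
  have e : (fun x => ∑ i ∈ s, f i N x) = ∑ i ∈ s, f i N := by ext x; simp
  rw [e]
  exact eLpNorm_sum_le (fun i _ => hm i N) one_le_two

theorem restrict_prototypeBox (a b : ℝ) : (volume : Measure (ℝ × ℝ)).restrict (prototypeBox a b)
    = (volume.restrict (Ico 0 a)).prod (volume.restrict (Ico 0 b)) := by
  rw [Measure.prod_restrict, Measure.volume_eq_prod, prototypeBox]

theorem tendsto_setIntegral_partialSumSnd_mul {a b : ℝ} (hb : 0 < b) {f g : ℝ × ℝ → ℂ}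
    (hf : IntegrableOn f (prototypeBox a b)) (hg : ContDiff ℝ ∞ g) (hgc : HasCompactSupport g) :
    Tendsto (fun N => ∫ z in prototypeBox a b, (partialSumSnd b N f z - f z) * g z)
      atTop (𝓝 0) := by
  unfold IntegrableOn at hf
  rw [restrict_prototypeBox] at hf ⊢
  have hg' : Continuous fun z => fderiv ℝ g z (0, 1) :=
    (hg.continuous_fderiv (by simp)).clm_apply continuous_const
  obtain ⟨K, hK⟩ := hgc.exists_bound_of_continuous hg.continuous
  obtain ⟨K', hK'⟩ := (hgc.fderiv_apply (𝕜 := ℝ) (0, 1)).exists_bound_of_continuous hg'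
  refine tendsto_integral_partialSumSnd_mul hb hf hg.continuous hg'
    (fun z => (hK z).trans (le_max_left K K')) (fun z => (hK' z).trans (le_max_right K K'))
    fun z => ?_
  have h1 : HasFDerivAt g (fderiv ℝ g z) z := (hg.differentiable (by simp) z).hasFDerivAt
  have h2 : HasDerivAt (fun v : ℝ => (z.1, v)) (0, 1) z.2 :=
    (hasDerivAt_const z.2 z.1).prodMk (hasDerivAt_id z.2)
  exact HasFDerivAt.comp_hasDerivAt z.2 h1 h2

section

variable {L : ℕ} {a b : ℝ} {c : ZMod L → ℂ} {C : ℝ × ℝ → ℝ} {κ : Fin L → ℤ}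
  {α : Fin L × Fin L → Fin L → Fin L → ℂ}

theorem integrable_tilePiece_mul_phase (hC : Integrable C) (j : Fin L × Fin L) (p p' : Fin L) :
    Integrable fun z : ℝ × ℝ => tilePiece a b κ C j z * phase a p p' z.2 := by
  refine (hC.comp_add_right _).ofReal.mul_bdd (c := 1) ?_ (ae_of_all _ fun z => (norm_phase _ _ _ _).le)
  exact ((contDiff_phase a p p').continuous.comp continuous_snd).aestronglyMeasurable

theorem memLp_tilePiece_mul_phase (hC : MemLp C 2) (j : Fin L × Fin L) (p p' : Fin L) :
    MemLp (fun z : ℝ × ℝ => tilePiece a b κ C j z * phase a p p' z.2) 2 := by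
  have h1 : MemLp (tilePiece a b κ C j) 2 :=
    (hC.comp_measurePreserving (measurePreserving_add_right volume _)).ofReal
  refine h1.of_le (h1.1.mul ?_) (ae_of_all _ fun z => ?_)
  · exact ((contDiff_phase a p p').continuous.comp continuous_snd).aestronglyMeasurable
  · rw [norm_mul, norm_phase, mul_one]

theorem aestronglyMeasurable_phase_snd_neg (p p' : Fin L) (μ : Measure (ℝ × ℝ)) :
    AEStronglyMeasurable (fun z : ℝ × ℝ => phase a p p' (-z.2)) μ :=
  ((contDiff_phase a p p').continuous.comp continuous_snd.neg).aestronglyMeasurable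

theorem integrableOn_tileError_term (hC : Integrable C) (N : ℕ) (j j' : Fin L × Fin L)
    (p p' : Fin L) : IntegrableOn (fun z : ℝ × ℝ => α j p p' * shiftTensor c p p' j' *
      (phase a p p' (-z.2) *
        (partialSumSnd b N (fun z => tilePiece a b κ C j' z * phase a p p' z.2) z -
          tilePiece a b κ C j' z * phase a p p' z.2))) (prototypeBox a b) := by
  have h1 : IntegrableOn (fun z : ℝ × ℝ => tilePiece a b κ C j' z * phase a p p' z.2)
      (prototypeBox a b) := (integrable_tilePiece_mul_phase hC j' p p').integrableOn
  refine Integrable.const_mul ?_ _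
  refine Integrable.bdd_mul (c := 1) (Integrable.sub ?_ h1)
    (aestronglyMeasurable_phase_snd_neg p p' _) (ae_of_all _ fun z => (norm_phase _ _ _ _).le)
  unfold IntegrableOn at h1
  rw [restrict_prototypeBox] at h1 ⊢
  exact integrable_partialSumSnd N h1

theorem integrableOn_tileError (hC : Integrable C) (N : ℕ) (j : Fin L × Fin L) :
    IntegrableOn (tileError a b κ c α C N j) (prototypeBox a b) :=
  integrable_finsetSum _ fun p _ => integrable_finsetSum _ fun p' _ =>
    integrable_finsetSum _ fun j' _ => integrableOn_tileError_term hC N j j' p p'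

theorem tendsto_setIntegral_tileError_mul (hb : 0 < b) (hC : Integrable C) (j : Fin L × Fin L)
    {g : ℝ × ℝ → ℂ} (hg : ContDiff ℝ ∞ g) (hgc : HasCompactSupport g) :
    Tendsto (fun N => ∫ z in prototypeBox a b, tileError a b κ c α C N j z * g z)
      atTop (𝓝 0) := by
  obtain ⟨K, hK⟩ := hgc.exists_bound_of_continuous hg.continuous
  have hi : ∀ N p p' j', IntegrableOn (fun z : ℝ × ℝ => (α j p p' * shiftTensor c p p' j' *
      (phase a p p' (-z.2) *
        (partialSumSnd b N (fun z => tilePiece a b κ C j' z * phase a p p' z.2) z -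
          tilePiece a b κ C j' z * phase a p p' z.2))) * g z) (prototypeBox a b) :=
    fun N p p' j' => (integrableOn_tileError_term hC N j j' p p').mul_bdd
      hg.continuous.aestronglyMeasurable (ae_of_all _ hK)
  have e : ∀ N, ∫ z in prototypeBox a b, tileError a b κ c α C N j z * g z
      = ∑ p, ∑ p', ∑ j', ∫ z in prototypeBox a b, (α j p p' * shiftTensor c p p' j' *
      (phase a p p' (-z.2) *
        (partialSumSnd b N (fun z => tilePiece a b κ C j' z * phase a p p' z.2) z -
          tilePiece a b κ C j' z * phase a p p' z.2))) * g z := by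
    intro N
    unfold tileError
    simp_rw [Finset.sum_mul]
    rw [integral_finsetSum _ fun p _ => integrable_finsetSum _ fun p' _ =>
      integrable_finsetSum _ fun j' _ => hi N p p' j']
    refine Finset.sum_congr rfl fun p _ => ?_
    rw [integral_finsetSum _ fun p' _ => integrable_finsetSum _ fun j' _ => hi N p p' j']
    refine Finset.sum_congr rfl fun p' _ => ?_
    rw [integral_finsetSum _ fun j' _ => hi N p p' j']
  simp_rw [e]
  have hz : ∀ p p' j', Tendsto (fun N => ∫ z in prototypeBox a b,
      (α j p p' * shiftTensor c p p' j' * (phase a p p' (-z.2) *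
        (partialSumSnd b N (fun z => tilePiece a b κ C j' z * phase a p p' z.2) z -
          tilePiece a b κ C j' z * phase a p p' z.2))) * g z) atTop (𝓝 0) := by
    intro p p' j'
    -- The demodulating phase is absorbed into the test function.
    have hG : ContDiff ℝ ∞ fun z : ℝ × ℝ => phase a p p' (-z.2) * g z :=
      ((contDiff_phase a p p').comp contDiff_snd.neg).mul hg
    have h := (tendsto_setIntegral_partialSumSnd_mul (a := a) hb
      (integrable_tilePiece_mul_phase (a := a) (b := b) (κ := κ) hC j' p p').integrableOn hG
      hgc.mul_left).const_mul (α j p p' * shiftTensor c p p' j')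
    rw [mul_zero] at h
    refine h.congr fun N => ?_
    rw [← integral_const_mul]
    refine integral_congr_ae (ae_of_all _ fun z => ?_)
    simp only
    ring
  have := tendsto_finsetSum Finset.univ fun p _ => tendsto_finsetSum Finset.univ fun p' _ =>
    tendsto_finsetSum Finset.univ fun j' _ => hz p p' j'
  simpa using this

theorem tendsto_eLpNorm_tileError (hb : 0 < b) (hC : Integrable C) (hC2 : MemLp C 2)
    (j : Fin L × Fin L) :
    Tendsto (fun N => eLpNorm (tileError a b κ c α C N j) 2 (volume.restrict (prototypeBox a b)))
      atTop (𝓝 0) := by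
  have hm : ∀ N p p' j', AEStronglyMeasurable (fun z : ℝ × ℝ => α j p p' * shiftTensor c p p' j' *
      (phase a p p' (-z.2) *
        (partialSumSnd b N (fun z => tilePiece a b κ C j' z * phase a p p' z.2) z -
          tilePiece a b κ C j' z * phase a p p' z.2))) (volume.restrict (prototypeBox a b)) :=
    fun N p p' j' => (integrableOn_tileError_term hC N j j' p p').1
  unfold tileError
  refine tendsto_eLpNorm_finset_sum _ (fun p N => ?_) fun p =>
    tendsto_eLpNorm_finset_sum _ (fun p' N => ?_) fun p' =>
    tendsto_eLpNorm_finset_sum _ (fun j' N => hm N p p' j') fun j' => ?_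
  · exact Finset.aestronglyMeasurable_fun_sum _ fun p' _ =>
      Finset.aestronglyMeasurable_fun_sum _ fun j' _ => hm N p p' j'
  · exact Finset.aestronglyMeasurable_fun_sum _ fun j' _ => hm N p p' j'
  have hf : MemLp (fun z : ℝ × ℝ => tilePiece a b κ C j' z * phase a p p' z.2) 2
      (volume.restrict (prototypeBox a b)) := (memLp_tilePiece_mul_phase hC2 j' p p').restrict _
  rw [restrict_prototypeBox] at hf ⊢
  have h := ENNReal.Tendsto.const_mul (a := ENNReal.ofReal ‖α j p p' * shiftTensor c p p' j'‖)
    (tendsto_eLpNorm_partialSumSnd hb hf) (Or.inr ENNReal.ofReal_ne_top)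
  rw [mul_zero] at h
  refine tendsto_of_tendsto_of_tendsto_of_le_of_le tendsto_const_nhds h (fun _ => zero_le) fun N => ?_
  refine eLpNorm_le_mul_eLpNorm_of_ae_le_mul (ae_of_all _ fun z => ?_) _
  rw [norm_mul, norm_mul (phase _ _ _ _), norm_phase, one_mul]

/-- Reconstruction at one point involves the slices of `C` in every column; finitely many translates
of a null set are still null. -/
theorem ae_slice_integrable (hC : Integrable C) :
    ∀ᵐ z : ℝ × ℝ, ∀ j i : Fin L, Integrable fun ν => C (z.1 - a * κ j + a * κ i, ν) := by
  have h0 : ∀ᵐ t : ℝ, Integrable fun ν => C (t, ν) := by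
    rw [Measure.volume_eq_prod] at hC
    exact hC.prod_right_ae
  have h1 : ∀ᵐ t : ℝ, ∀ j i : Fin L, Integrable fun ν => C (t - a * κ j + a * κ i, ν) := by
    rw [ae_all_iff]; intro j
    rw [ae_all_iff]; intro i
    have := (measurePreserving_add_right (volume : Measure ℝ)
      (-(a * κ j) + a * κ i)).quasiMeasurePreserving.ae h0
    filter_upwards [this] with t ht
    rwa [← add_assoc, ← sub_eq_add_neg] at ht
  rw [Measure.volume_eq_prod]
  exact Measure.quasiMeasurePreserving_fst.ae h1

theorem reconstruction_ae_eq (k n : Fin L × Fin L → ℤ) {Φ Φ' : ℤ → ℝ → ℂ}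
    (h : ∀ d, Φ d =ᵐ[volume] Φ' d) : ∀ᵐ z : ℝ × ℝ, ∀ N,
      reconstruction a b α k n Φ N z = reconstruction a b α k n Φ' N z := by
  have h1 : ∀ᵐ t : ℝ, ∀ (d : ℤ) (j : Fin L × Fin L) (p : Fin L),
      Φ d (t - a * (k j - (p : ℕ))) = Φ' d (t - a * (k j - (p : ℕ))) := by
    rw [ae_all_iff]; intro d
    rw [ae_all_iff]; intro j
    rw [ae_all_iff]; intro p
    exact (measurePreserving_sub_right (volume : Measure ℝ) _).quasiMeasurePreserving.ae (h d)
  have h2 : ∀ᵐ z : ℝ × ℝ, ∀ (d : ℤ) (j : Fin L × Fin L) (p : Fin L),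
      Φ d (z.1 - a * (k j - (p : ℕ))) = Φ' d (z.1 - a * (k j - (p : ℕ))) := by
    rw [Measure.volume_eq_prod]
    exact Measure.quasiMeasurePreserving_fst.ae h1
  filter_upwards [h2] with z hz N
  unfold reconstruction
  simp_rw [hz]

/-- The tiles are disjoint, and off their union both the reconstruction and `C` vanish, so the
global error is the sum of the tile errors. -/
theorem reconstruction_sub_ae_eq (ha : 0 < a) (hb : 0 < b) (hab : a * b * L = 1)
    (hκ : Function.Injective κ) (hκL : ∀ i, ((κ i : ℤ) : ZMod L) = ((i : ℕ) : ZMod L))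
    (hα : IsDualArray c α) (hC : IsTiled a b κ C) (hCi : Integrable C) {Φ : ℤ → ℝ → ℂ}
    (hΦ : ∀ d, Φ d =ᵐ[volume] responseDensity a c C d) :
    ∀ᵐ z : ℝ × ℝ, ∀ N, reconstruction a b α (fun j => κ j.1) (fun j => κ j.2) Φ N z - (C z : ℂ)
      = ∑ j : Fin L × Fin L, (prototypeBox a b).indicator (tileError a b κ c α C N j)
          (z - (a * κ j.1, b * κ j.2)) := by
  filter_upwards [reconstruction_ae_eq (fun j => κ j.1) (fun j => κ j.2) hΦ,
    ae_slice_integrable (a := a) (κ := κ) hCi] with z hz hslice N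
  rw [hz]
  set D : ℝ × ℝ → ℂ := fun z => reconstruction a b α (fun j => κ j.1) (fun j => κ j.2)
    (responseDensity a c C) N z - (C z : ℂ) with hD
  change D z = _
  rw [← sum_indicator_translate (τ := fun j : Fin L × Fin L => ((a * κ j.1, b * κ j.2) : ℝ × ℝ))
    (B := prototypeBox a b) (f := D) ?_ ?_ z]
  · refine Finset.sum_congr rfl fun j _ => ?_
    by_cases hj : z - (a * κ j.1, b * κ j.2) ∈ prototypeBox a b
    · rw [indicator_of_mem hj, indicator_of_mem hj]
      exact reconstruction_sub_eq_tileError ha hb hab hκ hκL hα hC hj (fun i => hslice j.1 i) j N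
    · rw [indicator_of_notMem hj, indicator_of_notMem hj]
  · intro z j j' hj hj'
    exact Prod.ext (hκ (eq_of_sub_mul_mem_Ico ha hj.1 hj'.1))
      (hκ (eq_of_sub_mul_mem_Ico hb hj.2 hj'.2))
  · intro z hne
    by_contra! hc
    refine hne ?_
    have h0 : C z = 0 := by
      by_contra h
      obtain ⟨j, hj⟩ := hC z h
      exact hc j hj
    have h1 : reconstruction a b α (fun j => κ j.1) (fun j => κ j.2)
        (responseDensity a c C) N z = 0 := by
      unfold reconstruction
      rw [Finset.sum_eq_zero, mul_zero]
      intro j _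
      refine mul_eq_zero_of_left (indicator_of_notMem (hc j) _) _
    simp only [hD, h1, h0, Complex.ofReal_zero, sub_zero]

theorem measurableSet_prototypeBox : MeasurableSet (prototypeBox a b) :=
  measurableSet_Ico.prod measurableSet_Ico

theorem tendsto_integral_reconstruction (ha : 0 < a) (hb : 0 < b) (hab : a * b * L = 1)
    (hκ : Function.Injective κ) (hκL : ∀ i, ((κ i : ℤ) : ZMod L) = ((i : ℕ) : ZMod L))
    (hα : IsDualArray c α) (hC : IsTiled a b κ C) (hCi : Integrable C) {Φ : ℤ → ℝ → ℂ}
    (hΦ : ∀ d, Φ d =ᵐ[volume] responseDensity a c C d) {g : ℝ × ℝ → ℂ} (hg : ContDiff ℝ ∞ g)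
    (hgc : HasCompactSupport g) :
    Tendsto (fun N : ℕ => ∫ z,
      reconstruction a b α (fun j => κ j.1) (fun j => κ j.2) Φ N z * g z) atTop
        (𝓝 (∫ z, (C z : ℂ) * g z)) := by
  obtain ⟨K, hK⟩ := hgc.exists_bound_of_continuous hg.continuous
  set τ : Fin L × Fin L → ℝ × ℝ := fun j => (a * κ j.1, b * κ j.2) with hτ
  have hlim : ∀ j, Tendsto (fun N => ∫ z in prototypeBox a b,
      tileError a b κ c α C N j z * g (z + τ j)) atTop (𝓝 0) := fun j =>
    tendsto_setIntegral_tileError_mul hb hCi j (hg.comp (contDiff_id.add contDiff_const))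
      (hgc.comp_homeomorph (Homeomorph.addRight (τ j)))
  have hsum := tendsto_finsetSum Finset.univ fun j _ => hlim j
  rw [Finset.sum_const_zero] at hsum
  have h2 := hsum.const_add (∫ z, (C z : ℂ) * g z)
  rw [add_zero] at h2
  refine h2.congr fun N => ?_
  have hT : ∀ j, Integrable fun z =>
      (prototypeBox a b).indicator (fun w => tileError a b κ c α C N j w * g (w + τ j))
        (z - τ j) := by
    intro j
    refine Integrable.comp_sub_right ?_ (τ j)
    rw [integrable_indicator_iff measurableSet_prototypeBox]
    exact (integrableOn_tileError hCi N j).mul_bdd (c := K)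
      (hg.continuous.comp (by fun_prop)).aestronglyMeasurable (ae_of_all _ fun z => hK _)
  have hCg : Integrable fun z => (C z : ℂ) * g z :=
    hCi.ofReal.mul_bdd hg.continuous.aestronglyMeasurable (ae_of_all _ hK)
  have e : ∀ᵐ z : ℝ × ℝ, reconstruction a b α (fun j => κ j.1) (fun j => κ j.2) Φ N z * g z
      = (C z : ℂ) * g z + ∑ j, (prototypeBox a b).indicator
        (fun w => tileError a b κ c α C N j w * g (w + τ j)) (z - τ j) := by
    filter_upwards [reconstruction_sub_ae_eq ha hb hab hκ hκL hα hC hCi hΦ] with z hz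
    rw [← sub_eq_iff_eq_add', ← sub_mul, hz N, Finset.sum_mul]
    refine Finset.sum_congr rfl fun j _ => ?_
    by_cases hj : z - τ j ∈ prototypeBox a b
    · rw [indicator_of_mem hj, indicator_of_mem hj, sub_add_cancel]
    · rw [indicator_of_notMem hj, indicator_of_notMem hj, zero_mul]
  rw [integral_congr_ae e, integral_add hCg (integrable_finsetSum _ fun j _ => hT j),
    integral_finsetSum _ fun j _ => hT j]
  congr 1
  refine Finset.sum_congr rfl fun j _ => ?_
  rw [integral_sub_right_eq_self (fun z => (prototypeBox a b).indicator
    (fun w => tileError a b κ c α C N j w * g (w + τ j)) z) (τ j),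
    integral_indicator measurableSet_prototypeBox]

theorem tendsto_eLpNorm_reconstruction (ha : 0 < a) (hb : 0 < b) (hab : a * b * L = 1)
    (hκ : Function.Injective κ) (hκL : ∀ i, ((κ i : ℤ) : ZMod L) = ((i : ℕ) : ZMod L))
    (hα : IsDualArray c α) (hC : IsTiled a b κ C) (hCi : Integrable C) (hC2 : MemLp C 2)
    {Φ : ℤ → ℝ → ℂ} (hΦ : ∀ d, Φ d =ᵐ[volume] responseDensity a c C d) :
    Tendsto (fun N : ℕ => eLpNorm (fun z =>
      reconstruction a b α (fun j => κ j.1) (fun j => κ j.2) Φ N z - (C z : ℂ)) 2 volume)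
        atTop (𝓝 0) := by
  set τ : Fin L × Fin L → ℝ × ℝ := fun j => (a * κ j.1, b * κ j.2) with hτ
  have hm : ∀ N j, AEStronglyMeasurable
      ((prototypeBox a b).indicator (tileError a b κ c α C N j)) volume := fun N j =>
    (aestronglyMeasurable_indicator_iff measurableSet_prototypeBox).mpr
      (integrableOn_tileError hCi N j).1
  have hmp : ∀ j, MeasurePreserving (fun z : ℝ × ℝ => z - τ j) volume volume := fun j =>
    measurePreserving_sub_right volume (τ j)
  have key := tendsto_eLpNorm_finset_sum (μ := (volume : Measure (ℝ × ℝ)))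
    (f := fun (j : Fin L × Fin L) N z =>
      (prototypeBox a b).indicator (tileError a b κ c α C N j) (z - τ j)) Finset.univ
    (fun j N => (hm N j).comp_measurePreserving (hmp j)) fun j => by
      refine (tendsto_eLpNorm_tileError (a := a) (c := c) (κ := κ) (α := α) hb hCi hC2 j).congr fun N => ?_
      rw [← eLpNorm_indicator_eq_eLpNorm_restrict measurableSet_prototypeBox]
      exact (eLpNorm_comp_measurePreserving (hm N j) (hmp j)).symm
  refine key.congr fun N => eLpNorm_congr_ae ?_
  filter_upwards [reconstruction_sub_ae_eq ha hb hab hκ hκL hα hC hCi hΦ] with z hz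
  exact (hz N).symm

end

/-! ### The choice of the rectangles -/

/-- The representative of `i` modulo `L` in `[-⌊L/2⌋, L - ⌊L/2⌋)`. -/
def balancedRep (L : ℕ) (i : Fin L) : ℤ := if (i : ℕ) < L - L / 2 then (i : ℕ) else (i : ℕ) - L

theorem balancedRep_modEq (L : ℕ) (i : Fin L) : balancedRep L i ≡ (i : ℕ) [ZMOD L] := by
  unfold balancedRep
  split_ifs
  · rfl
  · exact (Int.modEq_iff_dvd.mpr ⟨1, by ring⟩)

theorem injective_balancedRep (L : ℕ) : Function.Injective (balancedRep L) := by
  intro i i' h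
  unfold balancedRep at h
  have := i.2
  have := i'.2
  apply Fin.ext
  split_ifs at h <;> omega

theorem exists_balancedRep_eq {L : ℕ} {q : ℤ} (h1 : -((L / 2 : ℕ) : ℤ) ≤ q)
    (h2 : q < (L : ℤ) - (L / 2 : ℕ)) : ∃ i, balancedRep L i = q := by
  by_cases hq : 0 ≤ q
  · refine ⟨⟨q.toNat, by omega⟩, ?_⟩
    unfold balancedRep
    simp only
    split_ifs <;> omega
  · refine ⟨⟨(q + L).toNat, by omega⟩, ?_⟩
    unfold balancedRep
    simp only
    split_ifs <;> omega

theorem exists_sub_mul_balancedRep_mem_Ico {L : ℕ} {a R x : ℝ} (ha : 0 < a)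
    (hR : 2 * R + 3 * a ≤ a * L) (hx : |x| ≤ R) : ∃ i, x - a * balancedRep L i ∈ Ico 0 a := by
  have hfl := Int.floor_le (x / a)
  have hlt := Int.lt_floor_add_one (x / a)
  set q := ⌊x / a⌋ with hq
  rw [le_div_iff₀' ha] at hfl
  rw [div_lt_iff₀' ha] at hlt
  have hx' := abs_le.mp hx
  -- Rounding down costs `a`, doubled to `2a`; the third `a` in `hR` gives strictness.
  have h1 : a * (-L) < a * (2 * q : ℝ) := by nlinarith
  have h2 : a * (2 * q : ℝ) < a * L := by nlinarith
  have h3 : (-L : ℤ) < 2 * q := by exact_mod_cast lt_of_mul_lt_mul_left h1 ha.le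
  have h4 : 2 * q < (L : ℤ) := by exact_mod_cast lt_of_mul_lt_mul_left h2 ha.le
  obtain ⟨i, hi⟩ := exists_balancedRep_eq (L := L) (q := q) (by omega) (by omega)
  refine ⟨i, ?_⟩
  rw [hi]
  constructor <;> linarith

theorem exists_prime_volume_lt {S : Set (ℝ × ℝ)} (hS : volume S ≠ ⊤) (R : ℝ) :
    ∃ L : ℕ, L.Prime ∧ Odd L ∧ volume S < (L : ℝ≥0∞) ∧ R ≤ L := by
  obtain ⟨n, hn⟩ := ENNReal.exists_nat_gt hS
  obtain ⟨m, hm⟩ := exists_nat_ge R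
  -- The summand `3` excludes the prime `2`, so `L` is odd.
  obtain ⟨L, hL, hp⟩ := Nat.exists_infinite_primes (n + m + 3)
  refine ⟨L, hp, hp.odd_of_ne_two (by omega), hn.trans_le ?_, hm.trans ?_⟩
  · exact_mod_cast (by omega : n ≤ L)
  · exact_mod_cast (by omega : m ≤ L)

theorem mainTheorem3 :
    ∃ α : (L : ℕ) → (ZMod L → ℂ) → Fin L × Fin L → Fin L → Fin L → ℂ,
    ∀ S : Set (ℝ × ℝ), IsCompact S →
    ∃ (L : ℕ) (a b : ℝ) (c : ZMod L → ℂ) (k n : Fin L × Fin L → ℤ),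
      L.Prime ∧ volume S < (L : ℝ≥0∞) ∧ 0 < a ∧ 0 < b ∧ a * b = 1 / (L : ℝ) ∧
      IsRectification a b k n S ∧
      ∀ (Ω : Type*) [MeasurableSpace Ω] (P : Measure Ω) [IsProbabilityMeasure P]
        (H : StochasticOperator P) (C : ℝ × ℝ → ℝ),
        IsWSSUS H C → tsupport C ⊆ S →
        ∀ χ : 𝓓((⊤ : Opens (ℝ × ℝ)), ℂ), (∀ᶠ z in 𝓝ˢ S, χ z = 1) →
          (∃ Φ : ℤ → ℝ → ℂ,
            IsLineDensity a (autocorrelation (H.response χ (deltaTrain a c))) Φ) ∧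
          ∀ Φ : ℤ → ℝ → ℂ,
            IsLineDensity a (autocorrelation (H.response χ (deltaTrain a c))) Φ →
            (∀ φ : 𝓓((⊤ : Opens (ℝ × ℝ)), ℂ),
              Tendsto (fun N : ℕ => ∫ z, reconstruction a b (α L c) k n Φ N z * φ z) atTop
                (𝓝 (∫ z, (C z : ℂ) * φ z))) ∧
            (MemLp C 2 volume →
              Tendsto (fun N : ℕ =>
                eLpNorm (fun z => reconstruction a b (α L c) k n Φ N z - (C z : ℂ)) 2 volume)
                atTop (𝓝 0)) := by
  refine ⟨dualArray, fun S hS => ?_⟩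
  obtain ⟨R, hR⟩ := hS.isBounded.exists_norm_le
  -- With `a = 1/√L ≤ 1` the grid has side `aL = √L ≥ 2|R| + 3 ≥ 2|R| + 3a`, as the covering
  -- requires. The absolute value is needed because `R` may be negative when `S` is empty.
  obtain ⟨L, hp, hodd, hvol, hL⟩ := exists_prime_volume_lt hS.measure_lt_top.ne ((2 * |R| + 3) ^ 2)
  have hLpos : (0 : ℝ) < L := by exact_mod_cast hp.pos
  set r := Real.sqrt L with hr
  have hrpos : 0 < r := Real.sqrt_pos.mpr hLpos
  have hrr : r * r = L := Real.mul_self_sqrt hLpos.le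
  have hrR : 2 * |R| + 3 ≤ r := Real.le_sqrt_of_sq_le hL
  set a : ℝ := 1 / r with hadef
  have ha : 0 < a := by positivity
  have haa : a * a = 1 / (L : ℝ) := by rw [hadef, ← hrr]; field_simp
  have haL : a * a * L = 1 := by rw [haa]; field_simp
  have hcov : 2 * |R| + 3 * a ≤ a * L := by
    have h1 : a * L = r := by rw [hadef, ← hrr]; field_simp
    have h2 : a ≤ 1 := by
      rw [hadef, div_le_one hrpos]; linarith [abs_nonneg R]
    linarith
  set κ := balancedRep L with hκdef
  have hκ : Function.Injective κ := injective_balancedRep L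
  have hκL : ∀ i, ((κ i : ℤ) : ZMod L) = ((i : ℕ) : ZMod L) := by
    intro i
    have := (ZMod.intCast_eq_intCast_iff _ _ _).mpr (balancedRep_modEq L i)
    exact_mod_cast this
  have hS1 : ∀ z ∈ S, |z.1| ≤ |R| := fun z hz =>
    ((norm_fst_le z).trans (hR z hz)).trans (le_abs_self R)
  have hS2 : ∀ z ∈ S, |z.2| ≤ |R| := fun z hz =>
    ((norm_snd_le z).trans (hR z hz)).trans (le_abs_self R)
  have htile : ∀ z ∈ S, ∃ j : Fin L × Fin L, z - (a * κ j.1, a * κ j.2) ∈ prototypeBox a a := by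
    intro z hz
    obtain ⟨i, hi⟩ := exists_sub_mul_balancedRep_mem_Ico ha hcov (hS1 z hz)
    obtain ⟨l, hl⟩ := exists_sub_mul_balancedRep_mem_Ico ha hcov (hS2 z hz)
    exact ⟨(i, l), hi, hl⟩
  refine ⟨L, a, a, geometricWindow L, fun j => κ j.1, fun j => κ j.2, hp, hvol, ha, ha, haa,
    ⟨fun j => balancedRep_modEq L j.1, fun j => balancedRep_modEq L j.2, fun z hz => ?_⟩, ?_⟩
  · obtain ⟨j, hj⟩ := htile z hz
    exact mem_iUnion.mpr ⟨j, hj⟩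
  intro Ω _ P _ H C hH hCS χ hχ
  have hsupp : ∀ z, C z ≠ 0 → z ∈ S := fun z hz => hCS (subset_tsupport C hz)
  -- Local integrability becomes global because the support lies in the compact set `S`.
  have hCi : Integrable C := (integrableOn_iff_integrable_of_support_subset hsupp).mp
    (hH.locallyIntegrable.integrableOn_isCompact hS)
  have hdens := isLineDensity_responseDensity (c := geometricWindow L) hH ha hCi
    (fun z hz => hS1 z (hsupp z hz)) (χ := χ) fun z hz => hχ.self_of_nhdsSet z (hsupp z hz)
  have hC : IsTiled a a κ C := fun z hz => htile z (hsupp z hz)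
  have hα := isDualArray_dualArray hodd
  refine ⟨⟨_, hdens⟩, fun Φ hΦ => ?_⟩
  have hae := fun d => hΦ.ae_eq ha hdens d
  exact ⟨fun φ => tendsto_integral_reconstruction ha ha haL hκ hκL hα hC hCi hae φ.contDiff
    φ.hasCompactSupport, fun hC2 =>
    tendsto_eLpNorm_reconstruction ha ha haL hκ hκL hα hC hCi hC2 hae⟩
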